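/- **Setting.** Let $X\subseteq\mathbb R^n$ be closed and convex, where $\mathbb R^n$ carries an arbitrary norm, let $h$ be convex and lower semicontinuous on $X$, and let $\omega:X\to\mathbb R$ be lower semicontinuous and strongly convex with modulus $1$. For $a\in X$ and a subgradient $\omega'(a)$ put $P_\omega(a,x)=\omega(x)-[\omega(a)+\langle\omega'(a),x-a\rangle]$. Let $x^0\in X$, let $\omega'(x^0)$ be a subgradient of $\omega$ at $x^0$, and let $\Omega_X\ge0$ satisfy $P_\omega(x^0,x)\le\Omega_X^2$ for all $x\in X$. For $i=1,\dots,m$ let $Y_i$ be a nonempty closed convex set in a finite-dimensional normed space, let $q_i$ be convex and lower semicontinuous on $Y_i$, let $v_i$ be lower semicontinuous and strongly convex with modulus $1$ on $Y_i$ with $0\le v_i\le\Omega_{Y_i}^2$ on $Y_i$, and let $A_i$ be a linear map. Consider $$\Psi^*=\min_{x\in X}\Big\{\Psi(x)=\sum_{i=1}^m f_i(x)+h(x)\Big\},\qquad f_i(x)=\max_{y\in Y_i}\langle A_ix,y\rangle-q_i(y).$$ Put $\|A\|=(\sum_i\|A_i\|^2)^{1/2}$, $\Omega_Y=(\sum_i\Omega_{Y_i}^2)^{1/2}$,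 assume $\|A\|\Omega_X\Omega_Y>0$, and for $\epsilon>0$ put $R=\|A\|\Omega_X\Omega_Y/\epsilon$. **Method.** Let $\delta=\epsilon/(2\Omega_Y^2)$, $\tilde f_i(x)=\max_{y\in Y_i}\langle A_ix,y\rangle-q_i(y)-\delta v_i(y)$, and $\mu=\epsilon/(4\Omega_X^2)$. The randomized primal-dual gradient (RPDG) method is applied to the smoothed and perturbed problem $$\min_{x\in X}\Big\{\sum_{i=1}^m\tilde f_i(x)+h(x)+\mu P_\omega(x^0,x)\Big\}.$$ With $L_i=\|A_i\|^2/\delta$, $L=\sum_iL_i$, $C=8L/\mu$ and $S=\sqrt{(m-1)^2+4mC}$ its parameters are $$p_i=\tfrac1{2m}+\tfrac{L_i}{2L},\quad \tau=\tfrac{S-(m-1)}{2m},\quad \eta=\tfrac{\mu S+\mu(m-1)}2,\quad \alpha=1-\tfrac1{(m+1)+S}.$$ Start with $x^{-1}=x^0$, $\underline x_i^0=x^0$, $y_i^0=\nabla\tilde f_i(x^0)$, $g^0=\sum_iy_i^0$. In iteration $t=1,2,\dots$ an index $i_t$ is drawn, independently of the earlier ones, with $\mathrm{Prob}\{i_t=i\}=p_i$.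 With $i=i_t$ put $\tilde x^t=\alpha(x^{t-1}-x^{t-2})+x^{t-1}$, $\underline x_i^t=(\tilde x^t+\tau\underline x_i^{t-1})/(1+\tau)$, $y_i^t=\nabla\tilde f_i(\underline x_i^t)$, leave the other $\underline x_j,y_j$ unchanged, and put $$x^t=\operatorname*{argmin}_{x\in X}\big\{\langle g^{t-1}+p_i^{-1}(y_i^t-y_i^{t-1}),x\rangle+h(x)+\mu P_\omega(x^0,x)+\eta P_\omega(x^{t-1},x)\big\},\qquad g^t=g^{t-1}+y_i^t-y_i^{t-1}.$$ Where $\omega$ is not differentiable, $\omega'(x^t)$ is any subgradient of $\omega$ at $x^t$ that satisfies, with some subgradient of $h$ at $x^t$, the optimality condition of this subproblem (selected as a function of the data of the subproblem). The output after $k\ge1$ iterations is $\bar x^k=(\sum_{t=1}^k\alpha^{-t})^{-1}\sum_{t=1}^k\alpha^{-t}x^t\in X$. **Proposition.** The method is well defined (the minimizers and the required subgradients exist), and there is a universal constant $c>0$ such that for every such problem and every $\epsilon>0$ the following hold. 1. There is $K\ge1$ with $$K\le c\,(m+\sqrt m\,R)\log\big(m(2+R)\big),\quad\text{and}\quad K\le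 c\,\frac{\sqrt m\,\|A\|\Omega_X\Omega_Y}{\epsilon}\log\frac{m\|A\|\Omega_X\Omega_Y}{\epsilon}\ \text{ if }\ \epsilon\le\frac{\|A\|\Omega_X\Omega_Y}{2\sqrt m},$$ such that $\bar x^k\in X$ and $\mathbb E[\Psi(\bar x^k)-\Psi^*]\le\epsilon$ for all $k\ge K$. 2. For every $\lambda\in(0,1)$ there is $K\ge1$ with $$K\le c\,(m+\sqrt m\,R)\log\frac{m(2+R)}{\lambda},\quad\text{and}\quad K\le c\,\frac{\sqrt m\,\|A\|\Omega_X\Omega_Y}{\epsilon}\log\frac{m\|A\|\Omega_X\Omega_Y}{\lambda\epsilon}\ \text{ if }\ \epsilon\le\frac{\|A\|\Omega_X\Omega_Y}{2\sqrt m},$$ such that $\bar x^k\in X$ and $\mathrm{Prob}\{\Psi(\bar x^k)-\Psi^*>\epsilon\}\le\lambda$ for all $k\ge K$. -/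

import Mathlib

universe u v w

namespace StructuredRPDG

section ProxMapping

variable {E : Type u} [NormedAddCommGroup E] [NormedSpace ℝ E]

/-- `g` is a subgradient at `x` of the function `φ : X → ℝ`. -/
def IsSubgradientOn (X : Set E) (φ : E → ℝ) (x : E) (g : StrongDual ℝ E) : Prop :=
  ∀ y ∈ X, φ x + g (y - x) ≤ φ y

/-- The prox-function `P_ω(a, x) = ω(x) - [ω(a) + ⟨ω'(a), x - a⟩]`, where the subgradient `ω'(a)` that is
in use is the argument `w`. -/
def proxFun (ω : E → ℝ) (a : E) (w : StrongDual ℝ E) (x : E) : ℝ :=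
  ω x - (ω a + w (x - a))

/-- The objective `⟨g, x⟩ + h(x) + μ ω(x) + η P_ω(a, x)` of the prox-mapping, with `ω'(a) = w`. -/
def proxObjective (h ω : E → ℝ) (μ η : ℝ) (g : StrongDual ℝ E) (a : E) (w : StrongDual ℝ E)
    (x : E) : ℝ :=
  g x + h x + μ * ω x + η * proxFun ω a w x

/-- `b` is the value of the prox-mapping `M_X(g, a, η)` (computed with `ω'(a) = w`), and `w'` is an
admissible selection of `ω'(b)`: a subgradient of `ω` at `b` that satisfies, together with some
subgradient `s` of `h` at `b`, the optimality condition of the prox-subproblem. -/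
structure IsProxStep (X : Set E) (h ω : E → ℝ) (μ η : ℝ) (g : StrongDual ℝ E) (a : E)
    (w : StrongDual ℝ E) (b : E) (w' : StrongDual ℝ E) : Prop where
  mem : b ∈ X
  isMinOn : IsMinOn (proxObjective h ω μ η g a w) X b
  subgradient : IsSubgradientOn X ω b w'
  optimality : ∃ s : StrongDual ℝ E, IsSubgradientOn X h b s ∧
    ∀ x ∈ X, 0 ≤ (g + s + (μ + η) • w' - η • w) (x - b)

/-- `M` computes the prox-mapping: from `g`, a point `a` of `X` and the subgradient `ω'(a)` in use it
returns the minimizer and the subgradient of `ω` to be used there. -/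
def IsProxMapping (X : Set E) (h ω : E → ℝ) (μ η : ℝ)
    (M : StrongDual ℝ E → E → StrongDual ℝ E → E × StrongDual ℝ E) : Prop :=
  ∀ (g : StrongDual ℝ E) (a : E) (w : StrongDual ℝ E), a ∈ X → IsSubgradientOn X ω a w →
    IsProxStep X h ω μ η g a w (M g a w).1 (M g a w).2

end ProxMapping

section Method

variable {E : Type u} [NormedAddCommGroup E] [NormedSpace ℝ E] {m : ℕ}

/-- The variables kept by the method after iteration `t`: `x^t`, `x^{t-1}`, the subgradient `ω'(x^t)` in
use, the points `u_i` at which the component gradients were last evaluated, those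
gradients `y_i`, and their sum `g`. -/
structure State (E : Type u) [NormedAddCommGroup E] [NormedSpace ℝ E] (m : ℕ) where
  x : E
  xprev : E
  w : StrongDual ℝ E
  u : Fin m → E
  y : Fin m → StrongDual ℝ E
  g : StrongDual ℝ E

/-- Sampling probabilities and (constant) stepsizes. -/
structure Parameters (m : ℕ) where
  p : Fin m → ℝ
  τ : ℝ
  η : ℝ
  α : ℝ

/-- The nonuniform sampling and the stepsizes attached to the Lipschitz constants `L i` of the component
gradients and to the strong convexity modulus `μ`. -/
noncomputable def nonuniformParameters (L : Fin m → ℝ) (μ : ℝ) : Parameters m :=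
  let Ltot : ℝ := ∑ i, L i
  let C : ℝ := 8 * Ltot / μ
  let S : ℝ := Real.sqrt (((m : ℝ) - 1) ^ 2 + 4 * m * C)
  { p := fun i => 1 / (2 * m) + L i / (2 * Ltot)
    τ := (S - ((m : ℝ) - 1)) / (2 * m)
    η := (μ * S + μ * ((m : ℝ) - 1)) / 2
    α := 1 - 1 / (((m : ℝ) + 1) + S) }

/-- `x^0 = x^{-1} = u_i^0`, `y_i^0 = ∇f_i(x^0)`, `g^0 = ∑ y_i^0`. -/
def initialState (gradf : Fin m → E → StrongDual ℝ E) (x₀ : E) (w₀ : StrongDual ℝ E) :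
    State E m where
  x := x₀
  xprev := x₀
  w := w₀
  u := fun _ => x₀
  y := fun i => gradf i x₀
  g := ∑ i, gradf i x₀

/-- One iteration of the randomized primal-dual gradient method, with the sampled index `i`. -/
noncomputable def step (gradf : Fin m → E → StrongDual ℝ E) (par : Parameters m)
    (M : StrongDual ℝ E → E → StrongDual ℝ E → E × StrongDual ℝ E)
    (s : State E m) (i : Fin m) : State E m :=
  let xt : E := par.α • (s.x - s.xprev) + s.x
  let ui : E := (1 + par.τ)⁻¹ • (xt + par.τ • s.u i)
  let yi : StrongDual ℝ E := gradf i ui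
  let b := M (s.g + (par.p i)⁻¹ • (yi - s.y i)) s.x s.w
  { x := b.1
    xprev := s.x
    w := b.2
    u := Function.update s.u i ui
    y := Function.update s.y i yi
    g := s.g + (yi - s.y i) }

/-- The state after `t` iterations; `i t` is the index sampled in iteration `t + 1`. -/
noncomputable def iterate (gradf : Fin m → E → StrongDual ℝ E) (par : Parameters m)
    (M : StrongDual ℝ E → E → StrongDual ℝ E → E × StrongDual ℝ E)
    (x₀ : E) (w₀ : StrongDual ℝ E) (i : ℕ → Fin m) : ℕ → State E m
  | 0 => initialState gradf x₀ w₀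
  | t + 1 => step gradf par M (iterate gradf par M x₀ w₀ i t) (i t)

/-- The ergodic mean `(∑_{t=1}^k θ_t)⁻¹ ∑_{t=1}^k θ_t x^t`, `θ_t = α^{-t}`, after `k` iterations. -/
noncomputable def ergodicMean (gradf : Fin m → E → StrongDual ℝ E) (par : Parameters m)
    (M : StrongDual ℝ E → E → StrongDual ℝ E → E × StrongDual ℝ E)
    (x₀ : E) (w₀ : StrongDual ℝ E) (i : ℕ → Fin m) (k : ℕ) : E :=
  (∑ t ∈ Finset.Icc 1 k, (par.α ^ t)⁻¹)⁻¹ •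
    ∑ t ∈ Finset.Icc 1 k, (par.α ^ t)⁻¹ • (iterate gradf par M x₀ w₀ i t).x

/-- The indices are independent and each is distributed according to `p`. -/
structure IsSampling {Ω : Type w} [MeasurableSpace Ω] (ℙ : MeasureTheory.Measure Ω)
    (p : Fin m → ℝ) (i : ℕ → Ω → Fin m) : Prop where
  measurable : ∀ t, Measurable (i t)
  indep : ProbabilityTheory.iIndepFun i ℙ
  law : ∀ t j, ℙ {a | i t a = j} = ENNReal.ofReal (p j)

end Method

/-- The function `x ↦ max_{y ∈ Y} ⟨A x, y⟩ - φ(y)`. -/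
noncomputable def maxFun {E : Type u} [NormedAddCommGroup E] [NormedSpace ℝ E]
    {G : Type v} [NormedAddCommGroup G] [NormedSpace ℝ G]
    (A : E →L[ℝ] StrongDual ℝ G) (Y : Set G) (φ : G → ℝ) (x : E) : ℝ :=
  sSup ((fun y => A x y - φ y) '' Y)

/-- The data of a structured nonsmooth problem `min_{x ∈ X} ∑ f_i(x) + h(x)`,
`f_i(x) = max_{y ∈ Y_i} ⟨A_i x, y⟩ - q_i(y)`, with a distance generating function `ω` on `X`, smoothing
functions `v_i` on `Y_i`, and a starting point `x₀` with a subgradient `w₀` of `ω` there.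
The norms of `E` and of the `F i` are arbitrary. -/
structure Problem (m : ℕ) (E : Type u) [NormedAddCommGroup E] [NormedSpace ℝ E]
    (F : Fin m → Type v) [∀ i, NormedAddCommGroup (F i)] [∀ i, NormedSpace ℝ (F i)] where
  X : Set E
  isClosed_X : IsClosed X
  convex_X : Convex ℝ X
  h : E → ℝ
  convexOn_h : ConvexOn ℝ X h
  lsc_h : LowerSemicontinuousOn h X
  ω : E → ℝ
  strongConvexOn_ω : StrongConvexOn X 1 ω
  lsc_ω : LowerSemicontinuousOn ω X
  x₀ : E
  x₀_mem : x₀ ∈ X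
  w₀ : StrongDual ℝ E
  w₀_subgradient : IsSubgradientOn X ω x₀ w₀
  ΩX : ℝ
  ΩX_nonneg : 0 ≤ ΩX
  proxFun_le : ∀ x ∈ X, proxFun ω x₀ w₀ x ≤ ΩX ^ 2
  A : ∀ i, E →L[ℝ] StrongDual ℝ (F i)
  Y : ∀ i, Set (F i)
  nonempty_Y : ∀ i, (Y i).Nonempty
  isClosed_Y : ∀ i, IsClosed (Y i)
  convex_Y : ∀ i, Convex ℝ (Y i)
  q : ∀ i, F i → ℝ
  convexOn_q : ∀ i, ConvexOn ℝ (Y i) (q i)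
  lsc_q : ∀ i, LowerSemicontinuousOn (q i) (Y i)
  v : ∀ i, F i → ℝ
  strongConvexOn_v : ∀ i, StrongConvexOn (Y i) 1 (v i)
  lsc_v : ∀ i, LowerSemicontinuousOn (v i) (Y i)
  ΩYi : Fin m → ℝ
  v_nonneg : ∀ i, ∀ y ∈ Y i, 0 ≤ v i y
  v_le : ∀ i, ∀ y ∈ Y i, v i y ≤ ΩYi i ^ 2

namespace Problem

variable {m : ℕ} {E : Type u} [NormedAddCommGroup E] [NormedSpace ℝ E]
  {F : Fin m → Type v} [∀ i, NormedAddCommGroup (F i)] [∀ i, NormedSpace ℝ (F i)]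

/-- The nonsmooth objective `Ψ = ∑ f_i + h`. -/
noncomputable def Ψ (P : Problem m E F) (x : E) : ℝ :=
  (∑ i, maxFun (P.A i) (P.Y i) (P.q i) x) + P.h x

/-- The optimal value `Ψ*`. -/
noncomputable def Ψopt (P : Problem m E F) : ℝ :=
  sInf (P.Ψ '' P.X)

/-- `‖A‖ = (∑ ‖A_i‖²)^{1/2}`. -/
noncomputable def normA (P : Problem m E F) : ℝ :=
  Real.sqrt (∑ i, ‖P.A i‖ ^ 2)

/-- `Ω_Y = (∑ Ω_{Y_i}²)^{1/2}`. -/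
noncomputable def ΩY (P : Problem m E F) : ℝ :=
  Real.sqrt (∑ i, P.ΩYi i ^ 2)

/-- The scale invariant quantity `‖A‖ Ω_X Ω_Y / ε`. -/
noncomputable def ratio (P : Problem m E F) (ε : ℝ) : ℝ :=
  P.normA * P.ΩX * P.ΩY / ε

/-- The smoothing parameter `δ = ε / (2 Ω_Y²)`. -/
noncomputable def smoothingParam (P : Problem m E F) (ε : ℝ) : ℝ :=
  ε / (2 * P.ΩY ^ 2)

/-- The weight of the perturbation by `P_ω(x₀, ·)`. It is chosen for the accuracy `ε / 2` that the
smoothing leaves: `(ε / 2) / (2 Ω_X²)`. -/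
noncomputable def perturbParam (P : Problem m E F) (ε : ℝ) : ℝ :=
  (ε / 2) / (2 * P.ΩX ^ 2)

/-- The smooth approximation `max_{y ∈ Y_i} ⟨A_i x, y⟩ - q_i(y) - δ v_i(y)` of `f_i`. -/
noncomputable def smoothed (P : Problem m E F) (ε : ℝ) (i : Fin m) (x : E) : ℝ :=
  maxFun (P.A i) (P.Y i) (fun y => P.q i y + P.smoothingParam ε * P.v i y) x

/-- The linearly modified `h` for which `hPert + perturbParam * ω` is `h + perturbParam * P_ω(x₀, ·)`. -/
noncomputable def hPert (P : Problem m E F) (ε : ℝ) (x : E) : ℝ :=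
  P.h x - P.perturbParam ε * (P.ω P.x₀ + P.w₀ (x - P.x₀))

/-- The parameters for the Lipschitz constants `‖A_i‖² / δ` of the gradients of the smoothed components
and for the strong convexity modulus of the perturbation. -/
noncomputable def parameters (P : Problem m E F) (ε : ℝ) : Parameters m :=
  nonuniformParameters (fun i => ‖P.A i‖ ^ 2 / P.smoothingParam ε) (P.perturbParam ε)

/-- `M` computes the prox-mapping needed by the method. -/
def IsProx (P : Problem m E F) (ε : ℝ)
    (M : StrongDual ℝ E → E → StrongDual ℝ E → E × StrongDual ℝ E) : Prop :=
  IsProxMapping P.X (P.hPert ε) P.ω (P.perturbParam ε) (P.parameters ε).η M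

/-- The output after `k` iterations of the randomized primal-dual gradient method, applied to the smoothed
and perturbed problem. -/
noncomputable def output (P : Problem m E F) (ε : ℝ)
    (M : StrongDual ℝ E → E → StrongDual ℝ E → E × StrongDual ℝ E)
    (i : ℕ → Fin m) (k : ℕ) : E :=
  ergodicMean (fun j x => fderiv ℝ (P.smoothed ε j) x) (P.parameters ε) M P.x₀ P.w₀ i k

end Problem

end StructuredRPDG

/-! Smoothing and perturbation change the objective by at most `3ε/4`: `δ Ω_Y² = ε/2` bounds the
loss in the maxima, and `μ Ω_X² = ε/4` bounds the effect of the prox term. What remains is a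
composite problem whose smooth part has Lipschitz constants summing to `L = 8 R² μ`, and it has to
be solved to accuracy `ε/4` only (`gap_le_smoothedObjective_gap`, `sum_lipschitz_eq`).

Linear convergence comes from a Lyapunov function. `potential` combines the prox-distance from the
current point to the solution, the Bregman distances of the component points `u_i` weighted by
`(1+τ)/p_i`, a cross term coupling the dual error with the last primal increment, and the square of
that increment. The prox inequality, the first order condition at the solution and a mirror-descent
inequality in the dual bound the new potential by an expression affine in `1/p_j`
(`potential_step_le`). Averaging over `j` makes the gradient estimator unbiased, so the terms linear
in the dual error cancel and the stepsize relations leave a contraction by `α` in expectation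
(`sum_potential_step_le`). Young's inequality keeps the cross term under control, so the potential
is nonnegative (`le_potential`).

The optimality gap of each iterate is bounded pathwise by a polynomial in `m` and `R` times two
consecutive potentials (`gap_step_le`). Jensen's inequality transfers the decay to the ergodic mean
with rate `k α^k` (`integral_gap_ergodicMean_le`). Since `1/(1-α) = m+1+S` is `O(m + √m R)`, every
polynomial factor, including the initial potential, costs only a constant inside the iteration
count, as a power of `m(2+R)` under the logarithm.

The expectation bound is the case `λ = 1`. For the probability bound, the expected smoothed gap is
made at most `ελ/4`, and Markov's inequality is applied at level `ε/4`. -/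

namespace StructuredRPDG

/-! ### Convex analysis: sandwich theorem, subgradients, the prox-mapping. -/

section Convex

open Set Filter Topology

/-- Sandwich theorem on a convex set with nonempty interior. -/
theorem exists_affine_between_of_interior_nonempty {V : Type u} [NormedAddCommGroup V]
    [NormedSpace ℝ V] [FiniteDimensional ℝ V] {K : Set V} {φ ψ : V → ℝ}
    (hφ : ConvexOn ℝ K φ) (hψ : ConvexOn ℝ K ψ) (h0 : ∀ v ∈ K, 0 ≤ φ v + ψ v)
    (hK : (interior K).Nonempty) :
    ∃ (l : StrongDual ℝ V) (c : ℝ), ∀ v ∈ K, -φ v ≤ l v + c ∧ l v + c ≤ ψ v := by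
  obtain ⟨v₀, hv₀⟩ := hK
  have hint : interior K ⊆ K := interior_subset
  have hψi : ConvexOn ℝ (interior K) ψ := hψ.subset hint hψ.1.interior
  -- The strict epigraph of `ψ` is taken over the interior only: there `ψ` is continuous, so the
  -- epigraph is open and can be separated from the hypograph of `-φ` over all of `K`.
  have hA : Convex ℝ {p : V × ℝ | p.1 ∈ interior K ∧ ψ p.1 < p.2} := hψi.convex_strict_epigraph
  have hAo : IsOpen {p : V × ℝ | p.1 ∈ interior K ∧ ψ p.1 < p.2} := by
    have hc : ContinuousOn (fun p : V × ℝ => p.2 - ψ p.1) (interior K ×ˢ univ) := by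
      refine continuousOn_snd.sub (hψ.continuousOn_interior.comp continuousOn_fst ?_)
      intro p hp
      exact hp.1
    have := hc.isOpen_inter_preimage (isOpen_interior.prod isOpen_univ) (isOpen_Ioi (a := (0 : ℝ)))
    convert this using 1
    ext p
    simp [sub_pos]
  have hB : Convex ℝ {p : V × ℝ | p.1 ∈ K ∧ p.2 ≤ (-φ) p.1} := hφ.neg.convex_hypograph
  have hdisj : Disjoint {p : V × ℝ | p.1 ∈ interior K ∧ ψ p.1 < p.2}
      {p : V × ℝ | p.1 ∈ K ∧ p.2 ≤ (-φ) p.1} := by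
    rw [Set.disjoint_left]
    rintro p ⟨h1, h2⟩ ⟨h3, h4⟩
    have := h0 _ h3
    simp only [Pi.neg_apply] at h4
    linarith
  obtain ⟨f, u, hfA, hfB⟩ := geometric_hahn_banach_open hA hAo hB hdisj
  set k : ℝ := f (0, 1) with hk
  set l : StrongDual ℝ V := f.comp (ContinuousLinearMap.inl ℝ V ℝ) with hl
  have hf : ∀ v r, f (v, r) = l v + r * k := by
    intro v r
    have : ((v, r) : V × ℝ) = (v, 0) + r • (0, 1) := by simp
    rw [this, map_add, map_smul]
    simp [hl, hk]
  have hA' : ∀ v ∈ interior K, ∀ r, ψ v < r → l v + r * k < u := fun v hv r hr => by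
    have := hfA (v, r) ⟨hv, hr⟩
    rwa [hf] at this
  have hB' : ∀ v ∈ K, u ≤ l v + (-φ v) * k := fun v hv => by
    have := hfB (v, -φ v) ⟨hv, by simp⟩
    rwa [hf] at this
  -- The separating hyperplane is not vertical, because both sets have points above `v₀`.
  have hkneg : k < 0 := by
    by_contra hk0
    push Not at hk0
    have h1 := hA' v₀ hv₀ (ψ v₀ + 1) (by linarith)
    have h2 := hB' v₀ (hint hv₀)
    have h3 := h0 _ (hint hv₀)
    nlinarith
  have hAle : ∀ v ∈ interior K, l v + ψ v * k ≤ u := by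
    intro v hv
    have ht : Tendsto (fun r : ℝ => l v + r * k) (𝓝[>] (ψ v)) (𝓝 (l v + ψ v * k)) :=
      ((continuous_const.add (continuous_id.mul continuous_const)).tendsto _).mono_left
        nhdsWithin_le_nhds
    refine le_of_tendsto ht ?_
    filter_upwards [self_mem_nhdsWithin] with r hr
    exact (hA' v hv r hr).le
  -- Boundary points are reached along the segment to `v₀`. Convexity of `ψ` and `k < 0` act in the
  -- same direction, so no continuity of `ψ` at `v` is needed.
  have hAle' : ∀ v ∈ K, l v + ψ v * k ≤ u := by
    intro v hv
    have ht : Tendsto (fun s : ℝ => s * (l v₀ + ψ v₀ * k) + (1 - s) * (l v + ψ v * k))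
        (𝓝[>] 0) (𝓝 (0 * (l v₀ + ψ v₀ * k) + (1 - 0) * (l v + ψ v * k))) := by
      refine Tendsto.mono_left (Continuous.tendsto ?_ _) nhdsWithin_le_nhds
      fun_prop
    rw [zero_mul, zero_add, sub_zero, one_mul] at ht
    refine le_of_tendsto ht ?_
    have hmem : Ioo (0 : ℝ) 1 ∈ 𝓝[>] (0 : ℝ) := Ioo_mem_nhdsGT one_pos
    filter_upwards [hmem] with s hs
    have hmem := hψ.1.combo_interior_self_mem_interior hv₀ hv hs.1 (by linarith [hs.2] : 0 ≤ 1 - s)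
      (by ring)
    have h1 := hAle _ hmem
    have h2 := hψ.2 (hint hv₀) hv hs.1.le (by linarith [hs.2] : 0 ≤ 1 - s) (by ring)
    simp only [map_add, map_smul, smul_eq_mul] at h1 h2
    nlinarith
  refine ⟨(-k)⁻¹ • l, -u * (-k)⁻¹, fun v hv => ?_⟩
  have hk' : 0 < -k := by linarith
  have e1 : ((-k)⁻¹ • l) v + -u * (-k)⁻¹ = (l v - u) / (-k) := by
    simp only [smul_apply, smul_eq_mul]
    ring
  rw [e1]
  constructor
  · rw [le_div_iff₀ hk']
    linarith [hB' v hv]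
  · rw [div_le_iff₀ hk']
    linarith [hAle' v hv]

/-- The subdifferential sum rule at a minimizer of the sum of two convex functions with the same
domain `X`; no interiority of the minimizer is needed in finite dimension. -/
theorem exists_subgradients_of_isMinOn_add {E : Type u} [NormedAddCommGroup E]
    [NormedSpace ℝ E] [FiniteDimensional ℝ E] {X : Set E} {φ ψ : E → ℝ}
    (hφ : ConvexOn ℝ X φ) (hψ : ConvexOn ℝ X ψ) {b : E} (hb : b ∈ X)
    (hmin : ∀ x ∈ X, φ b + ψ b ≤ φ x + ψ x) :
    ∃ l : StrongDual ℝ E, IsSubgradientOn X φ b (-l) ∧ IsSubgradientOn X ψ b l := by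
  -- `X` may have empty interior in `E`, but its translate by `-b` has nonempty interior in its own
  -- span. The sandwich is found there and extended linearly.
  set D : Set E := (fun x => x - b) '' X
  set V : Submodule ℝ E := Submodule.span ℝ D
  set K : Set V := (Subtype.val : V → E) ⁻¹' D
  have hKmem : ∀ v : V, v ∈ K ↔ b + (v : E) ∈ X := by
    intro v
    constructor
    · rintro ⟨x, hx, hxv⟩
      have hx' : x - b = (v : E) := hxv
      rw [← hx']
      simpa using hx
    · intro h
      exact ⟨b + v, h, by simp⟩
  let T : V →ᵃ[ℝ] E := AffineMap.mk (fun v => b + (v : E)) V.subtype (by intro p q; simp; abel)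
  have hKT : K = T ⁻¹' X := by
    ext v
    exact hKmem v
  have hφT : ConvexOn ℝ K (fun v : V => φ (b + v) - φ b) := by
    have := (hφ.comp_affineMap T).add_const (-φ b)
    rw [hKT]
    exact this
  have hψT : ConvexOn ℝ K (fun v : V => ψ (b + v) - ψ b) := by
    have := (hψ.comp_affineMap T).add_const (-ψ b)
    rw [hKT]
    exact this
  have hzero : (0 : V) ∈ K := by
    rw [hKmem]
    simpa using hb
  have hint : (interior K).Nonempty := by
    rw [hφT.1.interior_nonempty_iff_affineSpan_eq_top,
      AffineSubspace.affineSpan_eq_top_iff_vectorSpan_eq_top_of_nonempty ℝ V V ⟨0, hzero⟩,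
      vectorSpan_eq_span_vsub_set_right ℝ hzero]
    simp only [vsub_eq_sub, sub_zero, image_id']
    exact Submodule.span_span_coe_preimage
  obtain ⟨l, c, hl⟩ := exists_affine_between_of_interior_nonempty hφT hψT
    (fun v hv => by
      have := hmin _ ((hKmem v).1 hv)
      linarith) hint
  -- Both translated functions vanish at the origin, which squeezes the constant term.
  have hc : c = 0 := by
    have := hl 0 hzero
    simp at this
    linarith
  subst hc
  obtain ⟨g, hg⟩ := LinearMap.exists_extend (l : V →ₗ[ℝ] ℝ)
  have hgl : ∀ x (hx : x ∈ X), ∃ v : V, (v : E) = x - b ∧ v ∈ K ∧ g (x - b) = l v := by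
    intro x hx
    refine ⟨⟨x - b, Submodule.subset_span ⟨x, hx, rfl⟩⟩, rfl, ?_, ?_⟩
    · rw [hKmem]
      simpa using hx
    · rw [← ContinuousLinearMap.coe_coe l, ← hg]
      rfl
  refine ⟨LinearMap.toContinuousLinearMap g, ?_, ?_⟩
  · intro x hx
    obtain ⟨v, hv, hvK, hgv⟩ := hgl x hx
    have := (hl v hvK).1
    rw [hv] at this
    simp only [add_sub_cancel, add_zero] at this
    simp only [neg_apply, LinearMap.coe_toContinuousLinearMap']
    rw [hgv]
    linarith
  · intro x hx
    obtain ⟨v, hv, hvK, hgv⟩ := hgl x hx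
    have := (hl v hvK).2
    rw [hv] at this
    simp only [add_sub_cancel, add_zero] at this
    simp only [LinearMap.coe_toContinuousLinearMap']
    rw [hgv]
    linarith

variable {E : Type u} [NormedAddCommGroup E] [NormedSpace ℝ E]

/-- A strongly convex function grows quadratically away from a supporting affine function. -/
theorem _root_.StrongConvexOn.half_norm_sq_le {X : Set E} {φ : E → ℝ} {δ : ℝ}
    (hφ : StrongConvexOn X δ φ) {a : E} (ha : a ∈ X) {w : StrongDual ℝ E}
    (hw : IsSubgradientOn X φ a w) {x : E} (hx : x ∈ X) :
    δ / 2 * ‖x - a‖ ^ 2 ≤ φ x - (φ a + w (x - a)) := by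
  -- Strong convexity between `a` and `x` against the subgradient inequality at a point near `a`;
  -- the lost factor `1 - s` disappears as `s → 0`.
  have key : ∀ s : ℝ, s ∈ Ioo (0 : ℝ) 1 →
      (1 - s) * (δ / 2 * ‖x - a‖ ^ 2) ≤ φ x - (φ a + w (x - a)) := by
    intro s hs
    have h1 := hφ.2 hx ha hs.1.le (by linarith [hs.2] : 0 ≤ 1 - s) (by ring)
    have h2 := hw _ (hφ.1 hx ha hs.1.le (by linarith [hs.2] : 0 ≤ 1 - s) (by ring))
    have e : s • x + (1 - s) • a - a = s • (x - a) := by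
      rw [smul_sub, sub_smul, one_smul]
      abel
    rw [e, map_smul] at h2
    simp only [smul_eq_mul] at h1 h2
    have h3 : s * ((1 - s) * (δ / 2 * ‖x - a‖ ^ 2)) ≤ s * (φ x - (φ a + w (x - a))) := by
      nlinarith
    exact le_of_mul_le_mul_left h3 hs.1
  have ht : Tendsto (fun s : ℝ => (1 - s) * (δ / 2 * ‖x - a‖ ^ 2)) (𝓝[>] 0)
      (𝓝 ((1 - 0) * (δ / 2 * ‖x - a‖ ^ 2))) := by
    refine Tendsto.mono_left (Continuous.tendsto ?_ _) nhdsWithin_le_nhds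
    fun_prop
  rw [sub_zero, one_mul] at ht
  refine le_of_tendsto ht ?_
  filter_upwards [Ioo_mem_nhdsGT (one_pos : (0 : ℝ) < 1)] with s hs
  exact key s hs

theorem half_norm_sq_le_proxFun {X : Set E} {ω : E → ℝ} (hω : StrongConvexOn X 1 ω) {a : E}
    (ha : a ∈ X) {w : StrongDual ℝ E} (hw : IsSubgradientOn X ω a w) {x : E} (hx : x ∈ X) :
    1 / 2 * ‖x - a‖ ^ 2 ≤ proxFun ω a w x :=
  hω.half_norm_sq_le ha hw hx

/-- At the midpoint strong convexity gains `‖x - y‖² / 8`, which cannot exceed the oscillation of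
`φ`. This is what makes the sets `Y_i` compact. -/
theorem _root_.StrongConvexOn.isBounded_of_bounds {X : Set E} {φ : E → ℝ} {c : ℝ}
    (hφ : StrongConvexOn X 1 φ) (h0 : ∀ x ∈ X, 0 ≤ φ x) (hc : ∀ x ∈ X, φ x ≤ c) :
    Bornology.IsBounded X := by
  rw [Metric.isBounded_iff]
  refine ⟨Real.sqrt (8 * c), fun x hx y hy => ?_⟩
  rw [dist_eq_norm]
  apply Real.le_sqrt_of_sq_le
  have h1 := hφ.2 hx hy (by norm_num : (0 : ℝ) ≤ 1 / 2) (by norm_num : (0 : ℝ) ≤ 1 / 2)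
    (by norm_num)
  have h2 := h0 _ (hφ.1 hx hy (by norm_num : (0 : ℝ) ≤ 1 / 2) (by norm_num : (0 : ℝ) ≤ 1 / 2)
    (by norm_num))
  simp only [smul_eq_mul] at h1
  have := hc x hx
  have := hc y hy
  linarith

/-- On a compact set the prox-mapping is well defined, including the subgradients of `ω` that the
optimality condition asks for. -/
theorem exists_isProxMapping [FiniteDimensional ℝ E] {X : Set E} (hX : IsCompact X)
    {h ω : E → ℝ} (hh : ConvexOn ℝ X h) (hlh : LowerSemicontinuousOn h X)
    (hω : ConvexOn ℝ X ω) (hlω : LowerSemicontinuousOn ω X) {μ η : ℝ} (hμη : 0 < μ + η) :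
    ∃ M, IsProxMapping X h ω μ η M := by
  have key : ∀ (g : StrongDual ℝ E) (a : E) (w : StrongDual ℝ E), ∃ r : E × StrongDual ℝ E,
      a ∈ X → IsSubgradientOn X ω a w → IsProxStep X h ω μ η g a w r.1 r.2 := by
    intro g a w
    by_cases ha : a ∈ X
    swap
    · exact ⟨(a, w), fun h => absurd h ha⟩
    -- Up to a constant the objective is `φ + (μ + η) ω`, since the linear part of the prox term
    -- joins `h` and `g`.
    set φ : E → ℝ := fun x => h x + (g - η • w) x with hφdef
    have hlin : ConvexOn ℝ X (fun x => (g - η • w) x) :=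
      ((g - η • w : StrongDual ℝ E) : E →ₗ[ℝ] ℝ).convexOn hh.1
    have hφ : ConvexOn ℝ X φ := hh.add hlin
    have hψ : ConvexOn ℝ X (fun x => (μ + η) * ω x) := hω.smul hμη.le
    have hlsc : LowerSemicontinuousOn (fun x => φ x + (μ + η) * ω x) X := by
      refine LowerSemicontinuousOn.add (hlh.add ?_) ?_
      · exact (g - η • w : StrongDual ℝ E).continuous.lowerSemicontinuous.lowerSemicontinuousOn _
      · exact (continuous_const_mul (μ + η)).comp_lowerSemicontinuousOn hlω
          (monotone_mul_left_of_nonneg hμη.le)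
    obtain ⟨b, hb, hmin⟩ := LowerSemicontinuousOn.exists_isMinOn ⟨a, ha⟩ hX hlsc
    have hmin' : ∀ x ∈ X, φ b + (μ + η) * ω b ≤ φ x + (μ + η) * ω x := fun x hx => hmin hx
    obtain ⟨l, hl1, hl2⟩ := exists_subgradients_of_isMinOn_add hφ hψ hb hmin'
    -- A sum-rule subgradient `l` of `(μ + η) ω` is rescaled to one of `ω`; its negative gives that
    -- of `h`. With these the functional in the optimality condition is identically zero.
    refine ⟨(b, (μ + η)⁻¹ • l), fun _ _ => ⟨hb, ?_, ?_, -l - (g - η • w), ?_, ?_⟩⟩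
    · intro x hx
      have := hmin' x hx
      simp only [hφdef, sub_apply, smul_apply,
        smul_eq_mul] at this
      simp only [mem_ofPred_eq, proxObjective, proxFun, map_sub]
      linarith
    · intro x hx
      have := hl2 x hx
      simp only [smul_apply, smul_eq_mul]
      have e : l (x - b) = (μ + η) * ((μ + η)⁻¹ * l (x - b)) := by field_simp
      have h3 : (μ + η) * (ω b + (μ + η)⁻¹ * l (x - b)) ≤ (μ + η) * ω x := by
        rw [mul_add, ← e]
        exact this
      exact le_of_mul_le_mul_left h3 hμη
    · intro x hx
      have := hl1 x hx
      simp only [hφdef, sub_apply, neg_apply, map_sub]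
        at this ⊢
      linarith
    · intro x hx
      have e : g + (-l - (g - η • w)) + (μ + η) • (μ + η)⁻¹ • l - η • w = 0 := by
        rw [smul_inv_smul₀ hμη.ne']
        abel
      rw [e]
      simp
  choose M hM using key
  exact ⟨M, hM⟩

end Convex

end StructuredRPDG

namespace StructuredRPDG

/-! ### Smooth convex functions and Nesterov smoothing of a maximum. -/

section Smooth

open Set Filter Topology

variable {E : Type u} [NormedAddCommGroup E] [NormedSpace ℝ E]
  {G : Type v} [NormedAddCommGroup G] [NormedSpace ℝ G]

/-- The Bregman distance `f(a) - f(b) - ⟨∇f(b), a - b⟩`. -/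
def bregman (f : E → ℝ) (f' : E → StrongDual ℝ E) (a b : E) : ℝ :=
  f a - f b - f' b (a - b)

/-- `f` is convex with gradient `f'`, which is Lipschitz continuous with constant `L`. -/
structure IsSmoothConvex (f : E → ℝ) (f' : E → StrongDual ℝ E) (L : ℝ) : Prop where
  nonneg : 0 ≤ L
  bregman_nonneg : ∀ a b, 0 ≤ bregman f f' a b
  bregman_le : ∀ a b, bregman f f' a b ≤ L / 2 * ‖a - b‖ ^ 2
  norm_sq_le : ∀ a b, ‖f' a - f' b‖ ^ 2 ≤ 2 * L * bregman f f' a b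

namespace IsSmoothConvex

variable {f : E → ℝ} {f' : E → StrongDual ℝ E} {L : ℝ}

theorem hasFDerivAt (hf : IsSmoothConvex f f' L) (x : E) : HasFDerivAt f (f' x) x := by
  rw [hasFDerivAt_iff_isLittleO]
  refine Asymptotics.IsBigO.trans_isLittleO (g := fun z => ‖z - x‖ ^ 2) ?_ ?_
  · refine Asymptotics.IsBigO.of_bound (L / 2) (Eventually.of_forall fun z => ?_)
    have h0 := hf.bregman_nonneg z x
    have h1 := hf.bregman_le z x
    rw [bregman] at h0 h1
    rw [Real.norm_of_nonneg h0, Real.norm_of_nonneg (by positivity)]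
    exact h1
  · have := Asymptotics.isLittleO_norm_pow_id (E' := E) (n := 2) one_lt_two
    have ht : Tendsto (fun z : E => z - x) (𝓝 x) (𝓝 0) := by
      have : Tendsto (fun z : E => z - x) (𝓝 x) (𝓝 (x - x)) :=
        (continuous_id.sub continuous_const).tendsto x
      rwa [sub_self] at this
    exact this.comp_tendsto ht

/-- Identifies the gradient built from maximizers with the `fderiv` used by the method. -/
theorem fderiv_eq (hf : IsSmoothConvex f f' L) : fderiv ℝ f = f' :=
  funext fun x => (hf.hasFDerivAt x).fderiv

theorem convexOn (hf : IsSmoothConvex f f' L) {X : Set E} (hX : Convex ℝ X) : ConvexOn ℝ X f := by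
  refine ⟨hX, fun a _ b _ s t hs ht hst => ?_⟩
  have h1 := hf.bregman_nonneg a (s • a + t • b)
  have h2 := hf.bregman_nonneg b (s • a + t • b)
  have e : s • (a - (s • a + t • b)) + t • (b - (s • a + t • b)) = 0 := by
    have : s • (s • a + t • b) + t • (s • a + t • b) = s • a + t • b := by
      rw [← add_smul, hst, one_smul]
    rw [smul_sub, smul_sub, sub_add_sub_comm, this, sub_self]
  have e2 := congrArg (f' (s • a + t • b)) e
  rw [map_add, map_smul, map_smul, map_zero] at e2
  simp only [bregman, smul_eq_mul] at h1 h2 e2 ⊢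
  have e3 : (s + t) * f (s • a + t • b) = f (s • a + t • b) := by rw [hst, one_mul]
  nlinarith [mul_nonneg hs h1, mul_nonneg ht h2]

end IsSmoothConvex

theorem bregman_three_point (f : E → ℝ) (f' : E → StrongDual ℝ E) (a b c : E) :
    bregman f f' a c - bregman f f' a b - bregman f f' b c = (f' b - f' c) (a - b) := by
  simp only [bregman, map_sub, sub_apply]
  ring

/-- A function that is strongly convex on a compact set and lower semicontinuous there has a maximum
after a linear modification, with quadratic decay away from the maximizer. -/
theorem exists_maximizer (A : E →L[ℝ] StrongDual ℝ G) {Y : Set G} (hY : IsCompact Y)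
    (hne : Y.Nonempty) {φ : G → ℝ} {δ : ℝ} (hφ : StrongConvexOn Y δ φ)
    (hl : LowerSemicontinuousOn φ Y) (x : E) :
    ∃ y ∈ Y, IsGreatest ((fun y => A x y - φ y) '' Y) (A x y - φ y) ∧
      ∀ z ∈ Y, A x z - φ z + δ / 2 * ‖z - y‖ ^ 2 ≤ A x y - φ y := by
  have hlsc : LowerSemicontinuousOn (fun y => φ y + (-(A x)) y) Y :=
    hl.add ((-(A x)).continuous.lowerSemicontinuous.lowerSemicontinuousOn _)
  obtain ⟨y, hy, hmin⟩ := LowerSemicontinuousOn.exists_isMinOn hne hY hlsc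
  have hmin' : ∀ z ∈ Y, φ y + (-(A x)) y ≤ φ z + (-(A x)) z := fun z hz => hmin hz
  have hsub : IsSubgradientOn Y φ y (A x) := by
    intro z hz
    have := hmin' z hz
    simp only [neg_apply, map_sub] at this ⊢
    linarith
  refine ⟨y, hy, ⟨⟨y, hy, rfl⟩, ?_⟩, ?_⟩
  · rintro _ ⟨z, hz, rfl⟩
    have := hmin' z hz
    simp only [neg_apply] at this ⊢
    linarith
  · intro z hz
    have := hφ.half_norm_sq_le hy hsub hz
    rw [map_sub] at this
    linarith

/-- The gradient at `x` is `y(x)` composed with `A`, where `y(x)` is the maximizer. Testing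
optimality of `y(a)` with `y(b)` bounds the Bregman distance below by `δ/2 ‖y(a) - y(b)‖²`, hence
nonnegativity and cocoercivity. Testing optimality of `y(b)` with `y(a)` bounds it above by
`A(a-b)(y(a)-y(b)) - δ/2 ‖y(a)-y(b)‖²`, and Young's inequality finishes. -/
theorem exists_isSmoothConvex_maxFun (A : E →L[ℝ] StrongDual ℝ G) {Y : Set G} (hY : IsCompact Y)
    (hne : Y.Nonempty) {φ : G → ℝ} {δ : ℝ} (hδ : 0 < δ) (hφ : StrongConvexOn Y δ φ)
    (hl : LowerSemicontinuousOn φ Y) :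
    ∃ f', IsSmoothConvex (maxFun A Y φ) f' (‖A‖ ^ 2 / δ) := by
  choose y hyY hgr hdec using exists_maximizer A hY hne hφ hl
  have hval : ∀ x, maxFun A Y φ x = A x (y x) - φ (y x) := fun x => (hgr x).csSup_eq
  have lower : ∀ a b, δ / 2 * ‖y a - y b‖ ^ 2 ≤
      bregman (maxFun A Y φ) (fun x => A.flip (y x)) a b := by
    intro a b
    have := hdec a (y b) (hyY b)
    rw [norm_sub_rev] at this
    simp only [bregman, hval, ContinuousLinearMap.flip_apply, map_sub]
    linarith
  refine ⟨fun x => A.flip (y x), by positivity, fun a b => ?_, fun a b => ?_, fun a b => ?_⟩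
  · exact le_trans (by positivity) (lower a b)
  · have h1 := hdec b (y a) (hyY a)
    have h2 : A (a - b) (y a - y b) ≤ ‖A‖ * ‖a - b‖ * ‖y a - y b‖ :=
      (Real.le_norm_self _).trans (A.le_opNorm₂ _ _)
    have h3 : ‖A‖ * ‖a - b‖ * ‖y a - y b‖ ≤
        ‖A‖ ^ 2 / δ / 2 * ‖a - b‖ ^ 2 + δ / 2 * ‖y a - y b‖ ^ 2 := by
      have e : ‖A‖ ^ 2 / δ / 2 * ‖a - b‖ ^ 2 + δ / 2 * ‖y a - y b‖ ^ 2
          - ‖A‖ * ‖a - b‖ * ‖y a - y b‖ = (‖A‖ * ‖a - b‖ - δ * ‖y a - y b‖) ^ 2 / (2 * δ) := by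
        field_simp
        ring
      have : 0 ≤ (‖A‖ * ‖a - b‖ - δ * ‖y a - y b‖) ^ 2 / (2 * δ) := by positivity
      linarith
    simp only [map_sub, sub_apply] at h2
    simp only [bregman, hval, ContinuousLinearMap.flip_apply, map_sub]
    linarith
  · have h1 : ‖A.flip (y a) - A.flip (y b)‖ ≤ ‖A‖ * ‖y a - y b‖ := by
      rw [← map_sub]
      exact (A.flip.le_opNorm _).trans_eq (by rw [ContinuousLinearMap.opNorm_flip])
    calc ‖A.flip (y a) - A.flip (y b)‖ ^ 2 ≤ (‖A‖ * ‖y a - y b‖) ^ 2 := by gcongr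
      _ = 2 * (‖A‖ ^ 2 / δ) * (δ / 2 * ‖y a - y b‖ ^ 2) := by field_simp
      _ ≤ _ := by
        gcongr
        exact lower a b

/-- A real `sSup` of an unbounded set is a default value, so attainment of the maximum is needed
here. Strong convexity with modulus `0` suffices for it. -/
theorem le_maxFun (A : E →L[ℝ] StrongDual ℝ G) {Y : Set G} (hY : IsCompact Y)
    (hne : Y.Nonempty) {φ : G → ℝ} (hφ : ConvexOn ℝ Y φ)
    (hl : LowerSemicontinuousOn φ Y) (x : E) {y : G} (hy : y ∈ Y) :
    A x y - φ y ≤ maxFun A Y φ x := by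
  obtain ⟨y₀, -, hgr, -⟩ := exists_maximizer A hY hne (strongConvexOn_zero.2 hφ) hl x
  rw [maxFun, hgr.csSup_eq]
  exact hgr.2 ⟨y, hy, rfl⟩

theorem maxFun_le (A : E →L[ℝ] StrongDual ℝ G) {Y : Set G}
    (hne : Y.Nonempty) {φ : G → ℝ} (x : E) {c : ℝ} (hc : ∀ y ∈ Y, A x y - φ y ≤ c) :
    maxFun A Y φ x ≤ c := by
  refine csSup_le (hne.image _) ?_
  rintro _ ⟨y, hy, rfl⟩
  exact hc y hy

end Smooth

end StructuredRPDG

namespace StructuredRPDG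

/-! ### The potential and its contraction in expectation. -/

section Lyapunov

open Set Filter Topology

variable {E : Type u} [NormedAddCommGroup E] [NormedSpace ℝ E] {m : ℕ}

/-- `xs` minimizes `∑ f_i + h + μ ω` over `X`, where the `f_i` are smooth and convex, `h` is convex and
`ω` is strongly convex. -/
structure IsCompositeMinimizer (X : Set E) (h ω : E → ℝ) (μ : ℝ) (f : Fin m → E → ℝ)
    (f' : Fin m → E → StrongDual ℝ E) (L : Fin m → ℝ) (xs : E) : Prop where
  convexOn_h : ConvexOn ℝ X h
  strongConvexOn_ω : StrongConvexOn X 1 ω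
  smooth : ∀ i, IsSmoothConvex (f i) (f' i) (L i)
  mem : xs ∈ X
  isMinOn : IsMinOn (fun x => ∑ i, f i x + h x + μ * ω x) X xs

/-- The relations between sampling probabilities, stepsizes, Lipschitz constants and modulus that the
convergence analysis uses. -/
structure IsAdmissible (par : Parameters m) (L : Fin m → ℝ) (μ : ℝ) : Prop where
  μ_pos : 0 < μ
  p_pos : ∀ i, 0 < par.p i
  p_sum : ∑ i, par.p i = 1
  L_le : ∀ i, L i ≤ 2 * (∑ j, L j) * par.p i
  one_le : ∀ i, 1 ≤ 2 * m * par.p i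
  τ_pos : 0 < par.τ
  η_pos : 0 < par.η
  coupling : par.η * par.τ = 8 * ∑ j, L j
  rate_dual : ∀ i, (1 - par.α) * (1 + par.τ) ≤ par.p i
  rate_primal : par.η ≤ par.α * (μ + par.η)
  α_nonneg : 0 ≤ par.α
  α_le_one : par.α ≤ 1

/-- The invariants of the states of the method. -/
structure IsConsistent (X : Set E) (ω : E → ℝ) (f' : Fin m → E → StrongDual ℝ E)
    (s : State E m) : Prop where
  mem : s.x ∈ X
  subgradient : IsSubgradientOn X ω s.x s.w
  y_eq : ∀ i, s.y i = f' i (s.u i)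
  g_eq : s.g = ∑ i, s.y i

/-- The potential of a state with respect to the solution `xs`. -/
noncomputable def potential (ω : E → ℝ) (μ : ℝ) (f : Fin m → E → ℝ)
    (f' : Fin m → E → StrongDual ℝ E) (par : Parameters m) (xs : E) (s : State E m) : ℝ :=
  (μ + par.η) * proxFun ω s.x s.w xs
    + ∑ i, (1 + par.τ) / par.p i * bregman (f i) (f' i) (s.u i) xs
    + (s.g - ∑ i, f' i xs) (s.x - s.xprev) + par.η / 4 * ‖s.x - s.xprev‖ ^ 2

variable {X : Set E} {h ω : E → ℝ} {μ : ℝ} {f : Fin m → E → ℝ}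
  {f' : Fin m → E → StrongDual ℝ E} {L : Fin m → ℝ} {xs : E} {par : Parameters m}
  {M : StrongDual ℝ E → E → StrongDual ℝ E → E × StrongDual ℝ E}

theorem isConsistent_initialState {x₀ : E} {w₀ : StrongDual ℝ E} (hx₀ : x₀ ∈ X)
    (hw₀ : IsSubgradientOn X ω x₀ w₀) : IsConsistent X ω f' (initialState f' x₀ w₀) :=
  ⟨hx₀, hw₀, fun _ => rfl, rfl⟩

theorem IsConsistent.step (hM : IsProxMapping X h ω μ par.η M) {s : State E m}
    (hs : IsConsistent X ω f' s) (j : Fin m) : IsConsistent X ω f' (step f' par M s j) := by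
  have hp := hM (s.g + (par.p j)⁻¹ •
    (f' j ((1 + par.τ)⁻¹ • (par.α • (s.x - s.xprev) + s.x + par.τ • s.u j)) - s.y j)) s.x s.w
    hs.mem hs.subgradient
  refine ⟨hp.mem, hp.subgradient, fun i => ?_, ?_⟩
  · by_cases hij : i = j
    · subst hij
      simp [StructuredRPDG.step]
    · simp [StructuredRPDG.step, Function.update_of_ne hij, hs.y_eq]
  · simp only [StructuredRPDG.step]
    rw [Finset.sum_update_of_mem (Finset.mem_univ j), hs.g_eq,
      ← Finset.add_sum_erase _ _ (Finset.mem_univ j), ← Finset.sdiff_singleton_eq_erase]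
    abel

theorem isConsistent_iterate (hM : IsProxMapping X h ω μ par.η M) {x₀ : E} {w₀ : StrongDual ℝ E}
    (hx₀ : x₀ ∈ X) (hw₀ : IsSubgradientOn X ω x₀ w₀) (i : ℕ → Fin m) (t : ℕ) :
    IsConsistent X ω f' (iterate f' par M x₀ w₀ i t) := by
  induction t with
  | zero => exact isConsistent_initialState hx₀ hw₀
  | succ t ih => exact ih.step hM (i t)

namespace IsCompositeMinimizer

/-- The first order optimality condition at the minimizer. -/
theorem first_order (hP : IsCompositeMinimizer X h ω μ f f' L xs) (hμ : 0 ≤ μ) {x : E}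
    (hx : x ∈ X) :
    0 ≤ (∑ i, f' i xs) (x - xs) + (h x + μ * ω x) - (h xs + μ * ω xs) := by
  set H : E → ℝ := fun x => h x + μ * ω x
  have hω : ConvexOn ℝ X ω := (strongConvexOn_zero.1 (hP.strongConvexOn_ω.mono zero_le_one))
  have hH : ConvexOn ℝ X H := hP.convexOn_h.add (hω.smul hμ)
  -- Moving by `s` towards `x` costs a smoothness error `s² c`, negligible after division by `s`.
  set c : ℝ := (∑ i, L i) / 2 * ‖x - xs‖ ^ 2
  have key : ∀ s ∈ Ioo (0 : ℝ) 1, 0 ≤ (∑ i, f' i xs) (x - xs) + H x - H xs + s * c := by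
    intro s hs
    have e : s • x + (1 - s) • xs = xs + s • (x - xs) := by
      rw [smul_sub, sub_smul, one_smul]
      abel
    have h1 := hH.2 hx hP.mem hs.1.le (by linarith [hs.2] : 0 ≤ 1 - s) (by ring)
    have hz := hH.1 hx hP.mem hs.1.le (by linarith [hs.2] : 0 ≤ 1 - s) (by ring)
    rw [e] at h1 hz
    have h2 : ∑ i, f i xs + h xs + μ * ω xs ≤ ∑ i, f i (xs + s • (x - xs)) +
      h (xs + s • (x - xs)) + μ * ω (xs + s • (x - xs)) := hP.isMinOn hz
    have h3 : ∑ i, f i (xs + s • (x - xs)) ≤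
        ∑ i, (f i xs + s * f' i xs (x - xs) + L i / 2 * (s ^ 2 * ‖x - xs‖ ^ 2)) := by
      refine Finset.sum_le_sum fun i _ => ?_
      have := (hP.smooth i).bregman_le (xs + s • (x - xs)) xs
      rw [bregman, add_sub_cancel_left, map_smul, norm_smul, Real.norm_of_nonneg hs.1.le,
        mul_pow, smul_eq_mul] at this
      linarith
    rw [Finset.sum_add_distrib, Finset.sum_add_distrib, ← Finset.mul_sum, ← Finset.sum_mul,
      ← Finset.sum_div] at h3
    have h4 : 0 ≤ s * ((∑ i, f' i xs) (x - xs) + H x - H xs + s * c) := by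
      rw [sum_apply]
      simp only [smul_eq_mul, H, c] at h1 ⊢
      nlinarith
    exact nonneg_of_mul_nonneg_right h4 hs.1
  have ht : Tendsto (fun s : ℝ => (∑ i, f' i xs) (x - xs) + H x - H xs + s * c) (𝓝[>] 0)
      (𝓝 ((∑ i, f' i xs) (x - xs) + H x - H xs + 0 * c)) := by
    refine Tendsto.mono_left (Continuous.tendsto ?_ _) nhdsWithin_le_nhds
    fun_prop
  rw [zero_mul, add_zero] at ht
  have := ge_of_tendsto ht (by
    filter_upwards [Ioo_mem_nhdsGT (one_pos : (0 : ℝ) < 1)] with s hs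
    exact key s hs)
  linarith

end IsCompositeMinimizer

/-- The prox step from `a` to `b` compared with a point `z`. -/
theorem IsProxStep.objective_le {η : ℝ} {g w w' : StrongDual ℝ E} {a b z : E}
    (hb : IsProxStep X h ω μ η g a w b w') (hz : z ∈ X) :
    (h b + μ * ω b) - (h z + μ * ω z) + (μ + η) * proxFun ω b w' z + η * proxFun ω a w b
      ≤ η * proxFun ω a w z - g (b - z) := by
  obtain ⟨s, hs, hopt⟩ := hb.optimality
  have h1 := hs z hz
  have h2 := hopt z hz
  simp only [proxFun, sub_apply, add_apply, smul_apply, map_sub, smul_eq_mul] at h1 h2 ⊢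
  nlinarith

/-- Young's inequality in the form that couples a dual increment with a primal one. -/
theorem inv_mul_norm_mul_le {n d a l lt p τ η : ℝ} (hd : 0 ≤ d)
    (hn : n ^ 2 ≤ 2 * l * d) (hp : 0 < p) (hτ : 0 ≤ τ) (hη0 : 0 ≤ η) (hl : l ≤ 2 * lt * p)
    (hη : η * τ = 8 * lt) : p⁻¹ * n * a ≤ p⁻¹ * (τ / 2 * d) + η / 4 * a ^ 2 := by
  have h1 : n * a ≤ τ / 2 * d + p * (η / 4 * a ^ 2) := by
    refine le_of_sq_le_sq ?_ (by positivity)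
    have hda : 0 ≤ d * a ^ 2 := by positivity
    calc (n * a) ^ 2 = n ^ 2 * a ^ 2 := by ring
      _ ≤ 2 * l * d * a ^ 2 := by gcongr
      _ = 2 * (l * (d * a ^ 2)) := by ring
      _ ≤ 2 * (2 * lt * p * (d * a ^ 2)) := by gcongr
      _ = η * τ / 2 * p * d * a ^ 2 := by rw [hη]; ring
      _ ≤ (τ / 2 * d + p * (η / 4 * a ^ 2)) ^ 2 := by
        nlinarith [sq_nonneg (τ / 2 * d - p * (η / 4 * a ^ 2))]
  calc p⁻¹ * n * a = p⁻¹ * (n * a) := by ring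
    _ ≤ p⁻¹ * (τ / 2 * d + p * (η / 4 * a ^ 2)) := by gcongr
    _ = _ := by field_simp

/-- The dual update compared with the solution. -/
theorem bregman_dual_step (hf : ∀ i, IsSmoothConvex (f i) (f' i) (L i)) {τ : ℝ} (hτ : 0 < τ)
    (i : Fin m) (xt u : E) :
    (1 + τ) * bregman (f i) (f' i) ((1 + τ)⁻¹ • (xt + τ • u)) xs
        + τ * bregman (f i) (f' i) u ((1 + τ)⁻¹ • (xt + τ • u))
      ≤ τ * bregman (f i) (f' i) u xs
        + (f' i ((1 + τ)⁻¹ • (xt + τ • u)) - f' i xs) (xt - xs) := by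
  set v := (1 + τ)⁻¹ • (xt + τ • u) with hv
  have hv' : τ • (u - v) = v - xt := by
    have : (1 + τ) • v = xt + τ • u := by rw [hv, smul_inv_smul₀ (by positivity)]
    rw [add_smul, one_smul] at this
    rw [smul_sub, sub_eq_sub_iff_add_eq_add, add_comm, ← this, add_comm]
  have h1 := bregman_three_point (f i) (f' i) u v xs
  have h2 : bregman (f i) (f' i) v xs ≤ (f' i v - f' i xs) (v - xs) := by
    have := (hf i).bregman_nonneg xs v
    simp only [bregman, sub_apply, map_sub] at this ⊢
    linarith
  have h3 : τ * (f' i v - f' i xs) (u - v) = (f' i v - f' i xs) (v - xt) := by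
    rw [← hv', map_smul, smul_eq_mul]
  have h4 : (f' i v - f' i xs) (v - xs) - (f' i v - f' i xs) (v - xt)
      = (f' i v - f' i xs) (xt - xs) := by
    rw [← map_sub]
    congr 1
    abel
  rw [← h1] at h3
  linarith

/-- One iteration changes the potential by at most a quantity which is affine in the inverse of
the sampling probability and does not involve the new state. -/
theorem potential_step_le (hP : IsCompositeMinimizer X h ω μ f f' L xs)
    (hpar : IsAdmissible par L μ) (hM : IsProxMapping X h ω μ par.η M) {s : State E m}
    (hs : IsConsistent X ω f' s) (j : Fin m) :
    potential ω μ f f' par xs (step f' par M s j) ≤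
      par.η * proxFun ω s.x s.w xs + par.α * (s.g - ∑ i, f' i xs) (s.x - s.xprev)
        + par.α ^ 2 * (par.η / 4 * ‖s.x - s.xprev‖ ^ 2)
        + ∑ i, (1 + par.τ) / par.p i * bregman (f i) (f' i) (s.u i) xs
        - (s.g - ∑ i, f' i xs) (par.α • (s.x - s.xprev) + s.x - xs)
        + (par.p j)⁻¹ * ((s.y j - f' j xs) (par.α • (s.x - s.xprev) + s.x - xs)
          - bregman (f j) (f' j) (s.u j) xs) := by
  have hp := hpar.p_pos j
  have hτ := hpar.τ_pos
  have hη := hpar.η_pos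
  set xt : E := par.α • (s.x - s.xprev) + s.x with hxt
  set v : E := (1 + par.τ)⁻¹ • (xt + par.τ • s.u j) with hv
  set gt : StrongDual ℝ E := s.g + (par.p j)⁻¹ • (f' j v - s.y j) with hgt
  set Ys : StrongDual ℝ E := ∑ i, f' i xs with hYs
  have hstep := hM gt s.x s.w hs.mem hs.subgradient
  set b : E := (M gt s.x s.w).1 with hb
  set w' : StrongDual ℝ E := (M gt s.x s.w).2 with hw'
  have hx' : (step f' par M s j).x = b := rfl
  have hxp' : (step f' par M s j).xprev = s.x := rfl
  have hww' : (step f' par M s j).w = w' := rfl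
  have hg' : (step f' par M s j).g = s.g + (f' j v - s.y j) := rfl
  have hu' : (step f' par M s j).u = Function.update s.u j v := rfl
  have hsum : ∑ i, (1 + par.τ) / par.p i * bregman (f i) (f' i) (Function.update s.u j v i) xs
      = ∑ i, (1 + par.τ) / par.p i * bregman (f i) (f' i) (s.u i) xs
        + (1 + par.τ) / par.p j * (bregman (f j) (f' j) v xs - bregman (f j) (f' j) (s.u j) xs) := by
    rw [← Finset.add_sum_erase _ _ (Finset.mem_univ j),
      ← Finset.add_sum_erase Finset.univ
        (fun i => (1 + par.τ) / par.p i * bregman (f i) (f' i) (s.u i) xs) (Finset.mem_univ j)]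
    rw [Function.update_self, Finset.sum_congr rfl (fun i hi => by
      rw [Function.update_of_ne (Finset.ne_of_mem_erase hi)])]
    ring
  rw [potential, hx', hxp', hww', hg', hu', hsum]
  have hprimal := hstep.objective_le hP.mem
  -- Added to `hprimal`, this removes the nonsmooth objective values and leaves `(Ys - gt) (b - xs)`
  -- as the only linear term.
  have hfo := hP.first_order hpar.μ_pos.le hstep.mem
  have hquad := half_norm_sq_le_proxFun hP.strongConvexOn_ω hs.mem hs.subgradient hstep.mem
  have hdual := bregman_dual_step (xs := xs) hP.smooth hτ j xt (s.u j)
  rw [← hv] at hdual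
  have hnsq : ‖f' j v - s.y j‖ ^ 2 ≤ 2 * L j * bregman (f j) (f' j) (s.u j) v := by
    rw [hs.y_eq, norm_sub_rev]
    exact (hP.smooth j).norm_sq_le _ _
  have hd0 := (hP.smooth j).bregman_nonneg (s.u j) v
  have hp1 : par.p j ≤ 1 := by
    rw [← hpar.p_sum]
    exact Finset.single_le_sum (fun i _ => (hpar.p_pos i).le) (Finset.mem_univ j)
  have hq1 : 0 ≤ (par.p j)⁻¹ - 1 := by
    rw [sub_nonneg]
    exact (one_le_inv₀ hp).2 hp1
  set q := (par.p j)⁻¹ with hq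
  have hq0 : 0 < q := by positivity
  -- Young's inequality is used twice, for the new and for the previous primal increment. Each use
  -- spends half of `τ` times the Bregman distance from `s.u j` to `v`. Of the `η/2 ‖b - s.x‖²` from
  -- the prox term, one half pays for `hy1`, the other becomes the last term of the new potential.
  have hy1 := inv_mul_norm_mul_le (a := ‖b - s.x‖) hd0 hnsq hp hτ.le hη.le
    (hpar.L_le j) hpar.coupling
  have hy2 := inv_mul_norm_mul_le (a := par.α * ‖s.x - s.xprev‖)
    hd0 hnsq hp hτ.le hη.le
    (hpar.L_le j) hpar.coupling
  rw [← hq] at hy1 hy2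
  have hc1 : -((q - 1) * (f' j v - s.y j) (b - s.x)) ≤ q * ‖f' j v - s.y j‖ * ‖b - s.x‖ := by
    have h1 : -((f' j v - s.y j) (b - s.x)) ≤ ‖f' j v - s.y j‖ * ‖b - s.x‖ :=
      (neg_le_abs _).trans ((f' j v - s.y j).le_opNorm _)
    have h2 : 0 ≤ ‖f' j v - s.y j‖ * ‖b - s.x‖ := by positivity
    nlinarith
  have hc2 : q * (par.α * (f' j v - s.y j) (s.x - s.xprev)) ≤
      q * ‖f' j v - s.y j‖ * (par.α * ‖s.x - s.xprev‖) := by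
    have h1 : (f' j v - s.y j) (s.x - s.xprev) ≤ ‖f' j v - s.y j‖ * ‖s.x - s.xprev‖ :=
      (le_abs_self _).trans ((f' j v - s.y j).le_opNorm _)
    calc q * (par.α * (f' j v - s.y j) (s.x - s.xprev))
        ≤ q * (par.α * (‖f' j v - s.y j‖ * ‖s.x - s.xprev‖)) := by
          have := hpar.α_nonneg
          gcongr
      _ = _ := by ring
  have hlin : (Ys - gt) (b - xs) + (s.g + (f' j v - s.y j) - Ys) (b - s.x) =
      par.α * (s.g - Ys) (s.x - s.xprev) + q * (par.α * (f' j v - s.y j) (s.x - s.xprev))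
      - (q - 1) * (f' j v - s.y j) (b - s.x) - (s.g - Ys) (xt - xs)
      - q * (f' j v - s.y j) (xt - xs) := by
    simp only [hgt, hxt, sub_apply, add_apply, smul_apply, map_sub, map_add, map_smul, smul_eq_mul]
    ring
  have hdual' : (1 + par.τ) / par.p j *
        (bregman (f j) (f' j) v xs - bregman (f j) (f' j) (s.u j) xs)
      + q * (par.τ * bregman (f j) (f' j) (s.u j) v)
      - q * (f' j v - s.y j) (xt - xs) ≤
      q * ((s.y j - f' j xs) (xt - xs) - bregman (f j) (f' j) (s.u j) xs) := by
    have e : (1 + par.τ) / par.p j = q * (1 + par.τ) := by rw [hq]; ring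
    rw [e]
    have e2 : (f' j v - s.y j) (xt - xs) = (f' j v - f' j xs) (xt - xs) - (s.y j - f' j xs) (xt - xs) := by
      simp only [sub_apply]
      ring
    rw [e2]
    nlinarith
  have hYgt : (Ys - gt) (b - xs) = Ys (b - xs) - gt (b - xs) := sub_apply _ _ _
  have hquad' : par.η * (1 / 2 * ‖b - s.x‖ ^ 2) ≤ par.η * proxFun ω s.x s.w b := by gcongr
  have e3 : par.η / 4 * (par.α * ‖s.x - s.xprev‖) ^ 2 =
    par.α ^ 2 * (par.η / 4 * ‖s.x - s.xprev‖ ^ 2) := by ring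
  rw [e3] at hy2
  linarith

/-- The potential decreases in expectation by the factor `α`. -/
theorem sum_potential_step_le (hP : IsCompositeMinimizer X h ω μ f f' L xs)
    (hpar : IsAdmissible par L μ) (hM : IsProxMapping X h ω μ par.η M) {s : State E m}
    (hs : IsConsistent X ω f' s) :
    ∑ j, par.p j * potential ω μ f f' par xs (step f' par M s j) ≤
      par.α * potential ω μ f f' par xs s := by
  set xt : E := par.α • (s.x - s.xprev) + s.x with hxt
  set Ys : StrongDual ℝ E := ∑ i, f' i xs with hYs
  set B : ℝ := par.η * proxFun ω s.x s.w xs + par.α * (s.g - Ys) (s.x - s.xprev)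
        + par.α ^ 2 * (par.η / 4 * ‖s.x - s.xprev‖ ^ 2)
        + ∑ i, (1 + par.τ) / par.p i * bregman (f i) (f' i) (s.u i) xs
        - (s.g - Ys) (xt - xs) with hB
  have h1 : ∑ j, par.p j * potential ω μ f f' par xs (step f' par M s j) ≤
      ∑ j, (par.p j * B + ((s.y j - f' j xs) (xt - xs) - bregman (f j) (f' j) (s.u j) xs)) := by
    refine Finset.sum_le_sum fun j _ => ?_
    have hp := hpar.p_pos j
    have := mul_le_mul_of_nonneg_left (potential_step_le hP hpar hM hs j) hp.le
    refine this.trans_eq ?_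
    rw [mul_add, ← mul_assoc (par.p j) (par.p j)⁻¹, mul_inv_cancel₀ hp.ne', one_mul]
  -- Unbiasedness: the factors `p_j` and `1/p_j` cancel, so the sum over `j` offsets the linear term
  -- in `B`.
  have h2 : ∑ j, (s.y j - f' j xs) (xt - xs) = (s.g - Ys) (xt - xs) := by
    rw [hs.g_eq, hYs, ← Finset.sum_sub_distrib, sum_apply]
  rw [Finset.sum_add_distrib, ← Finset.sum_mul, hpar.p_sum, one_mul, Finset.sum_sub_distrib, h2]
    at h1
  have h3 : ∑ i, (1 + par.τ) / par.p i * bregman (f i) (f' i) (s.u i) xs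
      - ∑ i, bregman (f i) (f' i) (s.u i) xs ≤
      par.α * ∑ i, (1 + par.τ) / par.p i * bregman (f i) (f' i) (s.u i) xs := by
    rw [← Finset.sum_sub_distrib, Finset.mul_sum]
    refine Finset.sum_le_sum fun i _ => ?_
    have hd := (hP.smooth i).bregman_nonneg (s.u i) xs
    have hr : (1 - par.α) * ((1 + par.τ) / par.p i) ≤ 1 := by
      rw [← mul_div_assoc, div_le_one (hpar.p_pos i)]
      exact hpar.rate_dual i
    nlinarith
  have hP0 : 0 ≤ proxFun ω s.x s.w xs :=
    le_trans (by positivity) (half_norm_sq_le_proxFun hP.strongConvexOn_ω hs.mem hs.subgradient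
      hP.mem)
  have h4 : par.η * proxFun ω s.x s.w xs ≤ par.α * ((μ + par.η) * proxFun ω s.x s.w xs) := by
    rw [← mul_assoc]
    exact mul_le_mul_of_nonneg_right hpar.rate_primal hP0
  have h5 : par.α ^ 2 * (par.η / 4 * ‖s.x - s.xprev‖ ^ 2) ≤
      par.α * (par.η / 4 * ‖s.x - s.xprev‖ ^ 2) := by
    have hα0 := hpar.α_nonneg
    have hα1 := hpar.α_le_one
    have hη := hpar.η_pos
    refine mul_le_mul_of_nonneg_right ?_ (by positivity)
    nlinarith
  rw [potential]
  linarith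

/-- The potential dominates the distances to the solution. -/
theorem le_potential (hP : IsCompositeMinimizer X h ω μ f f' L xs)
    (hpar : IsAdmissible par L μ) {s : State E m} (hs : IsConsistent X ω f' s) :
    (μ + par.η) * proxFun ω s.x s.w xs
      + 3 / 4 * ∑ i, (1 + par.τ) / par.p i * bregman (f i) (f' i) (s.u i) xs
      ≤ potential ω μ f f' par xs s := by
  set T : ℝ := ∑ i, (1 + par.τ) / par.p i * bregman (f i) (f' i) (s.u i) xs with hT
  have hτ := hpar.τ_pos
  have hη := hpar.η_pos
  set N : ℝ := ∑ i, ‖s.y i - f' i xs‖ with hN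
  have hN0 : 0 ≤ N := Finset.sum_nonneg fun i _ => norm_nonneg _
  have hg : ‖s.g - ∑ i, f' i xs‖ ≤ N := by
    rw [hs.g_eq, ← Finset.sum_sub_distrib]
    exact norm_sum_le _ _
  -- Cauchy–Schwarz with weights `2 L_i p_i / (1 + τ)`, whose sum is at most `2L/(1+τ) ≤ η/4`
  -- because `ητ = 8L`.
  have hNsq : N ^ 2 ≤ par.η / 4 * T := by
    have hcs := Finset.sum_sq_le_sum_mul_sum_of_sq_le_mul Finset.univ
      (r := fun i => ‖s.y i - f' i xs‖)
      (f := fun i => 2 * L i * par.p i / (1 + par.τ))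
      (g := fun i => (1 + par.τ) / par.p i * bregman (f i) (f' i) (s.u i) xs)
      (fun i _ => by
        have := hpar.p_pos i
        have := (hP.smooth i).nonneg
        positivity)
      (fun i _ => by
        have := hpar.p_pos i
        have := (hP.smooth i).bregman_nonneg (s.u i) xs
        positivity)
      (fun i _ => by
        have hp := hpar.p_pos i
        have := (hP.smooth i).norm_sq_le (s.u i) xs
        rw [hs.y_eq]
        refine this.trans_eq ?_
        field_simp)
    have hT0 : 0 ≤ T := Finset.sum_nonneg fun i _ => by
        have := hpar.p_pos i
        have := (hP.smooth i).bregman_nonneg (s.u i) xs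
        positivity
    have hsum : ∑ i, 2 * L i * par.p i / (1 + par.τ) ≤ par.η / 4 := by
      rw [← Finset.sum_div, div_le_iff₀ (by positivity)]
      have h1 : ∑ i, 2 * L i * par.p i ≤ ∑ i, 2 * L i := by
        refine Finset.sum_le_sum fun i _ => ?_
        have hp1 : par.p i ≤ 1 := by
          rw [← hpar.p_sum]
          exact Finset.single_le_sum (fun i _ => (hpar.p_pos i).le) (Finset.mem_univ i)
        have := (hP.smooth i).nonneg
        nlinarith
      rw [← Finset.mul_sum] at h1
      have := hpar.coupling
      nlinarith
    exact hcs.trans (mul_le_mul_of_nonneg_right hsum hT0)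
  set a : ℝ := ‖s.x - s.xprev‖ with ha
  have ha0 : 0 ≤ a := norm_nonneg _
  have hZ : -((s.g - ∑ i, f' i xs) (s.x - s.xprev)) ≤ N * a :=
    (neg_le_abs _).trans (((s.g - ∑ i, f' i xs).le_opNorm _).trans (by gcongr))
  have hNa : N * a ≤ T / 4 + par.η / 4 * a ^ 2 := by
    have h1 : 0 ≤ (N - par.η / 2 * a) ^ 2 := sq_nonneg _
    have h2 : par.η * (N * a) ≤ par.η * (T / 4 + par.η / 4 * a ^ 2) := by nlinarith
    exact le_of_mul_le_mul_left h2 hη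
  rw [potential]
  linarith

end Lyapunov

end StructuredRPDG

namespace StructuredRPDG

/-! ### Pathwise control of the optimality gap by the potential. -/

section Gap

variable {E : Type u} [NormedAddCommGroup E] [NormedSpace ℝ E] {m : ℕ}
  {X : Set E} {h ω : E → ℝ} {μ : ℝ} {f : Fin m → E → ℝ}
  {f' : Fin m → E → StrongDual ℝ E} {L : Fin m → ℝ} {xs : E} {par : Parameters m}
  {M : StrongDual ℝ E → E → StrongDual ℝ E → E × StrongDual ℝ E}

theorem potential_nonneg (hP : IsCompositeMinimizer X h ω μ f f' L xs)
    (hpar : IsAdmissible par L μ) {s : State E m} (hs : IsConsistent X ω f' s) :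
    0 ≤ potential ω μ f f' par xs s := by
  have h1 := le_potential hP hpar hs
  have hP0 : 0 ≤ proxFun ω s.x s.w xs :=
    le_trans (by positivity) (half_norm_sq_le_proxFun hP.strongConvexOn_ω hs.mem hs.subgradient
      hP.mem)
  have h2 : 0 ≤ ∑ i, (1 + par.τ) / par.p i * bregman (f i) (f' i) (s.u i) xs :=
    Finset.sum_nonneg fun i _ => by
      have := hpar.p_pos i
      have := hpar.τ_pos
      have := (hP.smooth i).bregman_nonneg (s.u i) xs
      positivity
  have := hpar.μ_pos
  have := hpar.η_pos
  have : 0 ≤ (μ + par.η) * proxFun ω s.x s.w xs := by positivity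
  linarith

theorem proxFun_le_potential (hP : IsCompositeMinimizer X h ω μ f f' L xs)
    (hpar : IsAdmissible par L μ) {s : State E m} (hs : IsConsistent X ω f' s) :
    (μ + par.η) * proxFun ω s.x s.w xs ≤ potential ω μ f f' par xs s := by
  have h1 := le_potential hP hpar hs
  have h2 : 0 ≤ ∑ i, (1 + par.τ) / par.p i * bregman (f i) (f' i) (s.u i) xs :=
    Finset.sum_nonneg fun i _ => by
      have := hpar.p_pos i
      have := hpar.τ_pos
      have := (hP.smooth i).bregman_nonneg (s.u i) xs
      positivity
  linarith

theorem norm_sub_sq_le_potential (hP : IsCompositeMinimizer X h ω μ f f' L xs)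
    (hpar : IsAdmissible par L μ) {s : State E m} (hs : IsConsistent X ω f' s) :
    μ * ‖s.x - xs‖ ^ 2 ≤ 2 * potential ω μ f f' par xs s := by
  have h1 := proxFun_le_potential hP hpar hs
  have h2 := half_norm_sq_le_proxFun hP.strongConvexOn_ω hs.mem hs.subgradient hP.mem
  rw [norm_sub_rev] at h2
  have := hpar.μ_pos
  have := hpar.η_pos
  have h3 : μ * ‖s.x - xs‖ ^ 2 ≤ (μ + par.η) * ‖s.x - xs‖ ^ 2 := by
    gcongr
    linarith
  have h4 : (μ + par.η) * (1 / 2 * ‖s.x - xs‖ ^ 2) ≤ (μ + par.η) * proxFun ω s.x s.w xs := by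
    gcongr
  linarith

theorem norm_dual_sub_sq_le_potential (hP : IsCompositeMinimizer X h ω μ f f' L xs)
    (hpar : IsAdmissible par L μ) {s : State E m} (hs : IsConsistent X ω f' s) (i : Fin m) :
    ‖s.y i - f' i xs‖ ^ 2 ≤ 3 * (∑ j, L j) * potential ω μ f f' par xs s := by
  have h1 := le_potential hP hpar hs
  have hP0 : 0 ≤ proxFun ω s.x s.w xs :=
    le_trans (by positivity) (half_norm_sq_le_proxFun hP.strongConvexOn_ω hs.mem hs.subgradient
      hP.mem)
  have hμ := hpar.μ_pos
  have hη := hpar.η_pos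
  have hτ := hpar.τ_pos
  have h0 : 0 ≤ (μ + par.η) * proxFun ω s.x s.w xs := by positivity
  have hd := (hP.smooth i).bregman_nonneg (s.u i) xs
  have hp1 : par.p i ≤ 1 := by
    rw [← hpar.p_sum]
    exact Finset.single_le_sum (fun i _ => (hpar.p_pos i).le) (Finset.mem_univ i)
  have h2 : (1 + par.τ) / par.p i * bregman (f i) (f' i) (s.u i) xs ≤
      ∑ i, (1 + par.τ) / par.p i * bregman (f i) (f' i) (s.u i) xs :=
    Finset.single_le_sum (f := fun i => (1 + par.τ) / par.p i * bregman (f i) (f' i) (s.u i) xs)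
      (fun i _ => by
        have := hpar.p_pos i
        have := (hP.smooth i).bregman_nonneg (s.u i) xs
        positivity) (Finset.mem_univ i)
  have h3 : bregman (f i) (f' i) (s.u i) xs ≤
      (1 + par.τ) / par.p i * bregman (f i) (f' i) (s.u i) xs := by
    refine le_mul_of_one_le_left hd ?_
    rw [le_div_iff₀ (hpar.p_pos i)]
    linarith
  have hL : L i ≤ ∑ j, L j :=
    Finset.single_le_sum (fun j _ => (hP.smooth j).nonneg) (Finset.mem_univ i)
  have hL0 := (hP.smooth i).nonneg
  have h4 := (hP.smooth i).norm_sq_le (s.u i) xs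
  rw [hs.y_eq]
  have hV : bregman (f i) (f' i) (s.u i) xs ≤ 4 / 3 * potential ω μ f f' par xs s := by linarith
  have hV0 := potential_nonneg hP hpar hs
  calc ‖f' i (s.u i) - f' i xs‖ ^ 2 ≤ 2 * L i * bregman (f i) (f' i) (s.u i) xs := h4
    _ ≤ 2 * (∑ j, L j) * (4 / 3 * potential ω μ f f' par xs s) := by
      have := hL0.trans hL
      gcongr
    _ ≤ 3 * (∑ j, L j) * potential ω μ f f' par xs s := by
      have : 0 ≤ (∑ j, L j) * potential ω μ f f' par xs s := mul_nonneg (hL0.trans hL) hV0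
      nlinarith

/-- The optimality gap after an iteration is controlled by the potentials before and after it. -/
theorem gap_step_le (hP : IsCompositeMinimizer X h ω μ f f' L xs)
    (hpar : IsAdmissible par L μ) (hM : IsProxMapping X h ω μ par.η M) {σ : ℝ} (hσ : 0 ≤ σ)
    (hL : ∑ i, L i ≤ σ ^ 2 * μ) {s : State E m} (hs : IsConsistent X ω f' s) (j : Fin m) :
    (∑ i, f i (step f' par M s j).x + h (step f' par M s j).x + μ * ω (step f' par M s j).x)
      - (∑ i, f i xs + h xs + μ * ω xs) ≤
    (1 + σ ^ 2 + 13 * m * σ) * (potential ω μ f f' par xs s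
      + potential ω μ f f' par xs (step f' par M s j)) := by
  have hs' := hs.step (f' := f') hM j
  set s' := step f' par M s j with hs'def
  have hV := potential_nonneg hP hpar hs
  have hV' := potential_nonneg hP hpar hs'
  have hprox := proxFun_le_potential hP hpar hs
  have hnx := norm_sub_sq_le_potential hP hpar hs'
  have hny := norm_dual_sub_sq_le_potential hP hpar hs
  have hny' := norm_dual_sub_sq_le_potential hP hpar hs'
  set V := potential ω μ f f' par xs s
  set V' := potential ω μ f f' par xs s'
  set v : E := (1 + par.τ)⁻¹ • (par.α • (s.x - s.xprev) + s.x + par.τ • s.u j) with hv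
  have hstep := hM (s.g + (par.p j)⁻¹ • (f' j v - s.y j)) s.x s.w hs.mem hs.subgradient
  have hx' : (M (s.g + (par.p j)⁻¹ • (f' j v - s.y j)) s.x s.w).1 = s'.x := rfl
  have hy' : s'.y j = f' j v := Function.update_self ..
  have hobj := hstep.objective_le hP.mem
  have hq0 := half_norm_sq_le_proxFun hP.strongConvexOn_ω hs.mem hs.subgradient hstep.mem
  have hq1 := half_norm_sq_le_proxFun hP.strongConvexOn_ω hstep.mem hstep.subgradient hP.mem
  have hq2 := half_norm_sq_le_proxFun hP.strongConvexOn_ω hs.mem hs.subgradient hP.mem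
  rw [hx'] at hobj hq0 hq1
  set gt := s.g + (par.p j)⁻¹ • (f' j v - s.y j) with hgt
  set Ys := ∑ i, f' i xs with hYs
  have hμ := hpar.μ_pos
  have hη := hpar.η_pos
  have hp := hpar.p_pos j
  set r := ‖s'.x - xs‖ with hr
  have hr0 : 0 ≤ r := norm_nonneg _
  -- The dual error is of order `√(σ²μ V)` and the primal one `√(V/μ)`, so `μ` cancels in the
  -- product; `5/2` is a bound for `√6`.
  have hnr : ∀ n : ℝ, n ^ 2 ≤ 3 * (σ ^ 2 * μ) * (V + V') → n * r ≤ 5 / 2 * σ * (V + V') := by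
    intro n hn
    refine le_of_sq_le_sq ?_ (by positivity)
    have hr2 : μ * r ^ 2 ≤ 2 * (V + V') := by linarith
    calc (n * r) ^ 2 = n ^ 2 * r ^ 2 := by ring
      _ ≤ 3 * (σ ^ 2 * μ) * (V + V') * r ^ 2 := by gcongr
      _ = 3 * σ ^ 2 * (V + V') * (μ * r ^ 2) := by ring
      _ ≤ 3 * σ ^ 2 * (V + V') * (2 * (V + V')) := by gcongr
      _ ≤ (5 / 2 * σ * (V + V')) ^ 2 := by nlinarith [sq_nonneg (σ * (V + V'))]
  have hny0 : ∀ i, ‖s.y i - f' i xs‖ * r ≤ 5 / 2 * σ * (V + V') := fun i => by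
    refine hnr _ ((hny i).trans ?_)
    gcongr
    linarith
  have hny1 : ‖f' j v - f' j xs‖ * r ≤ 5 / 2 * σ * (V + V') := by
    rw [← hy']
    refine hnr _ ((hny' j).trans ?_)
    gcongr
    linarith
  have hsmooth : ∑ i, f i s'.x - ∑ i, f i xs ≤ Ys (s'.x - xs) + (∑ i, L i) / 2 * r ^ 2 := by
    rw [hYs, sum_apply, Finset.sum_div, Finset.sum_mul, ← Finset.sum_add_distrib,
      ← Finset.sum_sub_distrib]
    refine Finset.sum_le_sum fun i _ => ?_
    have := (hP.smooth i).bregman_le s'.x xs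
    rw [bregman] at this
    linarith
  have hquad : (∑ i, L i) / 2 * r ^ 2 ≤ σ ^ 2 * (V + V') := by
    calc (∑ i, L i) / 2 * r ^ 2 ≤ (σ ^ 2 * μ) / 2 * r ^ 2 := by gcongr
      _ = σ ^ 2 / 2 * (μ * r ^ 2) := by ring
      _ ≤ σ ^ 2 / 2 * (2 * V') := by gcongr
      _ ≤ σ ^ 2 * (V + V') := by nlinarith [mul_nonneg (sq_nonneg σ) hV]
  have hgY : ‖gt - Ys‖ ≤ ∑ i, ‖s.y i - f' i xs‖
      + 2 * m * (‖f' j v - f' j xs‖ + ‖s.y j - f' j xs‖) := by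
    have e : gt - Ys = ∑ i, (s.y i - f' i xs)
        + (par.p j)⁻¹ • ((f' j v - f' j xs) - (s.y j - f' j xs)) := by
      rw [hgt, hYs, hs.g_eq, Finset.sum_sub_distrib, sub_sub_sub_cancel_right]
      abel
    rw [e]
    refine (norm_add_le _ _).trans (add_le_add (norm_sum_le _ _) ?_)
    rw [norm_smul, Real.norm_of_nonneg (by positivity)]
    have hinv : (par.p j)⁻¹ ≤ 2 * m := by
      rw [inv_le_iff_one_le_mul₀ hp]
      exact hpar.one_le j
    exact mul_le_mul hinv (norm_sub_le _ _) (norm_nonneg _) (by positivity)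
  -- There are `m` terms from the dual sum and, with `1/p_j ≤ 2m`, another `4m` from the estimator:
  -- `5m · 5/2 ≤ 13m`.
  have hlin : (Ys - gt) (s'.x - xs) ≤ 13 * m * σ * (V + V') := by
    calc (Ys - gt) (s'.x - xs) ≤ ‖Ys - gt‖ * r :=
          (Real.le_norm_self _).trans ((Ys - gt).le_opNorm _)
      _ ≤ (∑ i, ‖s.y i - f' i xs‖
          + 2 * m * (‖f' j v - f' j xs‖ + ‖s.y j - f' j xs‖)) * r := by
        rw [norm_sub_rev]
        gcongr
      _ = ∑ i, ‖s.y i - f' i xs‖ * r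
          + 2 * m * (‖f' j v - f' j xs‖ * r + ‖s.y j - f' j xs‖ * r) := by
        rw [add_mul, Finset.sum_mul]
        ring
      _ ≤ ∑ i : Fin m, 5 / 2 * σ * (V + V')
          + 2 * m * (5 / 2 * σ * (V + V') + 5 / 2 * σ * (V + V')) := by
        refine add_le_add (Finset.sum_le_sum fun i _ => hny0 i) ?_
        exact mul_le_mul_of_nonneg_left (add_le_add hny1 (hny0 j)) (by positivity)
      _ ≤ 13 * m * σ * (V + V') := by
        rw [Finset.sum_const, Finset.card_univ, Fintype.card_fin, nsmul_eq_mul]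
        have : 0 ≤ m * σ * (V + V') := by positivity
        nlinarith
  have h1 : 0 ≤ μ * proxFun ω s.x s.w xs := mul_nonneg hμ.le (le_trans (by positivity) hq2)
  have h2 : 0 ≤ (μ + par.η) * proxFun ω s'.x s'.w xs :=
    mul_nonneg (by positivity) (le_trans (by positivity) hq1)
  have h3 : 0 ≤ par.η * proxFun ω s.x s.w s'.x :=
    mul_nonneg hη.le (le_trans (by positivity) hq0)
  have h2' : (M gt s.x s.w).2 = s'.w := rfl
  rw [h2'] at hobj
  rw [sub_apply] at hlin
  linarith

end Gap

/-! ### Expectations of functions of finitely many sampled indices. -/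

section Expectation

open MeasureTheory ProbabilityTheory

variable {m : ℕ} {Ω : Type w} [MeasurableSpace Ω] {ν : Measure Ω} {p : Fin m → ℝ}
  {i : ℕ → Ω → Fin m}

/-- A function of the first `t` terms of a sequence, as a function of `t`-tuples. -/
theorem exists_factor_of_dependsOn {F : (ℕ → Fin m) → ℝ} {t : ℕ}
    (hF : DependsOn F (Finset.range t : Set ℕ)) :
    ∃ G : (Finset.range t → Fin m) → ℝ, ∀ i, F i = G fun k => i k := by
  classical
  by_cases hm : Nonempty (Fin m)
  · obtain ⟨j₀⟩ := hm
    -- The tail beyond `t` is filled with an arbitrary index, which `F` does not see.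
    refine ⟨fun z => F fun n => if hn : n ∈ Finset.range t then z ⟨n, hn⟩ else j₀, fun i => ?_⟩
    refine hF fun n hn => ?_
    have hn' : n ∈ Finset.range t := hn
    simp only [hn', dif_pos]
  · exact ⟨fun _ => 0, fun i => absurd ⟨i 0⟩ hm⟩

/-- Finitely many indices take finitely many values, so everything is integrable and no
measurability of the prox selection is required. -/
theorem IsSampling.integrable [IsFiniteMeasure ν] (hi : IsSampling ν p i)
    {F : (ℕ → Fin m) → ℝ} {t : ℕ} (hF : DependsOn F (Finset.range t : Set ℕ)) :
    Integrable (fun a => F fun k => i k a) ν := by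
  obtain ⟨G, hG⟩ := exists_factor_of_dependsOn hF
  simp only [hG]
  have hX : Measurable fun a => fun k : Finset.range t => i k a :=
    measurable_pi_lambda _ fun k => hi.measurable k
  exact (Integrable.of_finite (μ := ν.map _) (f := G)).comp_measurable hX

/-- Conditioning on the first `t` indices: by independence the joint law is a product, and Fubini on
finite spaces averages the next index. -/
theorem IsSampling.integral_succ [IsProbabilityMeasure ν] (hi : IsSampling ν p i)
    (hp : ∀ j, 0 ≤ p j)
    {F : (ℕ → Fin m) → Fin m → ℝ} {t : ℕ}
    (hF : ∀ j, DependsOn (fun i => F i j) (Finset.range t : Set ℕ)) :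
    ∫ a, F (fun k => i k a) (i t a) ∂ν = ∫ a, ∑ j, p j * F (fun k => i k a) j ∂ν := by
  choose G hG using fun j => exists_factor_of_dependsOn (hF j)
  simp only [hG]
  have hX : Measurable fun a => fun k : Finset.range t => i k a :=
    measurable_pi_lambda _ fun k => hi.measurable k
  set X : Ω → (Finset.range t → Fin m) := fun a => fun k : Finset.range t => i k a with hXdef
  have hind : IndepFun X (i t) ν := by
    have h1 := hi.indep.indepFun_finset (Finset.range t) {t} (by simp) hi.measurable
    exact h1.comp (φ := id) (ψ := fun z : ({t} : Finset ℕ) → Fin m => z ⟨t, by simp⟩)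
      measurable_id (measurable_pi_apply _)
  have hmap := (indepFun_iff_map_prod_eq_prod_map_map hX.aemeasurable
    (hi.measurable t).aemeasurable).1 hind
  have := Measure.isProbabilityMeasure_map (μ := ν) hX.aemeasurable
  have := Measure.isProbabilityMeasure_map (μ := ν) (hi.measurable t).aemeasurable
  have hlaw : ∀ j, (ν.map (i t)).real {j} = p j := by
    intro j
    rw [measureReal_def, Measure.map_apply (hi.measurable t) (measurableSet_singleton j)]
    have : i t ⁻¹' {j} = {a | i t a = j} := rfl
    rw [this, hi.law, ENNReal.toReal_ofReal (hp j)]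
  calc ∫ a, G (i t a) (X a) ∂ν
      = ∫ z, G z.2 z.1 ∂(ν.map fun a => (X a, i t a)) := by
        rw [integral_map (hX.prodMk (hi.measurable t)).aemeasurable]
        exact (measurable_of_finite _).aestronglyMeasurable
    _ = ∫ x, ∫ j, G j x ∂(ν.map (i t)) ∂(ν.map X) := by
        rw [hmap, integral_prod _ Integrable.of_finite]
    _ = ∫ x, ∑ j, p j * G j x ∂(ν.map X) := by
        congr 1
        ext x
        rw [integral_fintype Integrable.of_finite]
        simp only [hlaw, smul_eq_mul]
    _ = ∫ a, ∑ j, p j * G j (X a) ∂ν := by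
        rw [integral_map hX.aemeasurable]
        exact (measurable_of_finite _).aestronglyMeasurable

end Expectation

end StructuredRPDG

namespace StructuredRPDG

/-! ### Linear convergence in expectation and admissibility of the stepsizes. -/

section Convergence

open MeasureTheory ProbabilityTheory

variable {E : Type u} [NormedAddCommGroup E] [NormedSpace ℝ E] {m : ℕ}
  {X : Set E} {h ω : E → ℝ} {μ : ℝ} {f : Fin m → E → ℝ}
  {f' : Fin m → E → StrongDual ℝ E} {L : Fin m → ℝ} {xs : E} {par : Parameters m}
  {M : StrongDual ℝ E → E → StrongDual ℝ E → E × StrongDual ℝ E} {x₀ : E} {w₀ : StrongDual ℝ E}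
  {Ω : Type w} [MeasurableSpace Ω] {ν : Measure Ω} {i : ℕ → Ω → Fin m}

theorem dependsOn_iterate (t : ℕ) :
    DependsOn (fun i => iterate f' par M x₀ w₀ i t) (Finset.range t : Set ℕ) := by
  induction t with
  | zero => exact fun _ _ _ => rfl
  | succ t ih =>
    intro a b hab
    have h1 : iterate f' par M x₀ w₀ a t = iterate f' par M x₀ w₀ b t :=
      ih fun n hn => hab n (by
        simp only [Finset.coe_range, Set.mem_Iio] at hn ⊢
        omega)
    have h2 : a t = b t := hab t (by simp)
    simp only [iterate, h1, h2]

theorem dependsOn_ergodicMean (k : ℕ) :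
    DependsOn (fun i => ergodicMean f' par M x₀ w₀ i k) (Finset.range k : Set ℕ) := by
  intro a b hab
  simp only [ergodicMean]
  congr 1
  refine Finset.sum_congr rfl fun t ht => ?_
  have h1 : iterate f' par M x₀ w₀ a t = iterate f' par M x₀ w₀ b t :=
    dependsOn_iterate t fun n hn => hab n (by
      simp only [Finset.coe_range, Set.mem_Iio] at hn ⊢
      exact hn.trans_le (Finset.mem_Icc.1 ht).2)
  rw [h1]

theorem integrable_comp_iterate [IsFiniteMeasure ν] (hi : IsSampling ν par.p i)
    (φ : State E m → ℝ) (t : ℕ) :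
    Integrable (fun a => φ (iterate f' par M x₀ w₀ (fun k => i k a) t)) ν :=
  hi.integrable (F := fun i => φ (iterate f' par M x₀ w₀ i t)) (t := t)
    fun _ _ hab => congrArg φ (dependsOn_iterate t hab)

/-- The contraction for a fixed state is averaged over the past, which is independent of the next
index, and iterated. -/
theorem integral_potential_le [IsProbabilityMeasure ν]
    (hP : IsCompositeMinimizer X h ω μ f f' L xs)
    (hpar : IsAdmissible par L μ) (hM : IsProxMapping X h ω μ par.η M) (hx₀ : x₀ ∈ X)
    (hw₀ : IsSubgradientOn X ω x₀ w₀) (hi : IsSampling ν par.p i) (t : ℕ) :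
    ∫ a, potential ω μ f f' par xs (iterate f' par M x₀ w₀ (fun k => i k a) t) ∂ν ≤
      par.α ^ t * potential ω μ f f' par xs (initialState f' x₀ w₀) := by
  induction t with
  | zero => simp [iterate]
  | succ t ih =>
    have h1 := hi.integral_succ (fun j => (hpar.p_pos j).le) (t := t)
      (F := fun i j => potential ω μ f f' par xs (step f' par M (iterate f' par M x₀ w₀ i t) j))
      fun j _ _ hab => congrArg (fun s => potential ω μ f f' par xs (step f' par M s j))
        (dependsOn_iterate t hab)
    have h2 : ∫ a, ∑ j, par.p j * potential ω μ f f' par xs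
          (step f' par M (iterate f' par M x₀ w₀ (fun k => i k a) t) j) ∂ν ≤
        ∫ a, par.α * potential ω μ f f' par xs (iterate f' par M x₀ w₀ (fun k => i k a) t) ∂ν := by
      refine integral_mono ?_ ?_ fun a => ?_
      · exact integrable_comp_iterate hi
          (fun s => ∑ j, par.p j * potential ω μ f f' par xs (step f' par M s j)) t
      · exact integrable_comp_iterate hi (fun s => par.α * potential ω μ f f' par xs s) t
      · exact sum_potential_step_le hP hpar hM (isConsistent_iterate hM hx₀ hw₀ _ t)
    rw [integral_const_mul] at h2
    calc ∫ a, potential ω μ f f' par xs (iterate f' par M x₀ w₀ (fun k => i k a) (t + 1)) ∂ν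
        = _ := h1
      _ ≤ _ := h2
      _ ≤ par.α * (par.α ^ t * potential ω μ f f' par xs (initialState f' x₀ w₀)) :=
        mul_le_mul_of_nonneg_left ih hpar.α_nonneg
      _ = _ := by ring

/-- The optimality gap of the last iterate decreases linearly in expectation. -/
theorem integral_gap_iterate_le [IsProbabilityMeasure ν]
    (hP : IsCompositeMinimizer X h ω μ f f' L xs)
    (hpar : IsAdmissible par L μ) (hM : IsProxMapping X h ω μ par.η M) (hx₀ : x₀ ∈ X)
    (hw₀ : IsSubgradientOn X ω x₀ w₀) (hi : IsSampling ν par.p i) {σ : ℝ} (hσ : 0 ≤ σ)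
    (hL : ∑ i, L i ≤ σ ^ 2 * μ) {Φ : E → ℝ} (hΦ : ∀ x, Φ x = ∑ i, f i x + h x + μ * ω x) (t : ℕ) :
    ∫ a, (Φ (iterate f' par M x₀ w₀ (fun k => i k a) (t + 1)).x - Φ xs) ∂ν ≤
      2 * (1 + σ ^ 2 + 13 * m * σ) * potential ω μ f f' par xs (initialState f' x₀ w₀)
        * par.α ^ t := by
  set V₀ := potential ω μ f f' par xs (initialState f' x₀ w₀) with hV₀
  have hV₀0 : 0 ≤ V₀ := potential_nonneg hP hpar (isConsistent_initialState hx₀ hw₀)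
  set κ := 1 + σ ^ 2 + 13 * m * σ with hκ
  have hκ0 : 0 ≤ κ := by positivity
  have hI := fun t => integrable_comp_iterate (f' := f') (M := M) (x₀ := x₀) (w₀ := w₀) hi
    (potential ω μ f f' par xs) t
  have hE := integral_potential_le hP hpar hM hx₀ hw₀ hi
  have hα : par.α ^ (t + 1) ≤ par.α ^ t :=
    pow_le_pow_of_le_one hpar.α_nonneg hpar.α_le_one (Nat.le_succ t)
  calc ∫ a, (Φ (iterate f' par M x₀ w₀ (fun k => i k a) (t + 1)).x - Φ xs) ∂ν
      ≤ ∫ a, κ * (potential ω μ f f' par xs (iterate f' par M x₀ w₀ (fun k => i k a) t)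
        + potential ω μ f f' par xs (iterate f' par M x₀ w₀ (fun k => i k a) (t + 1))) ∂ν := by
        refine integral_mono ?_ (((hI t).add (hI (t + 1))).const_mul κ) fun a => ?_
        · exact integrable_comp_iterate hi (fun s => Φ s.x - Φ xs) (t + 1)
        · simp only [hΦ]
          exact gap_step_le hP hpar hM hσ hL (isConsistent_iterate hM hx₀ hw₀ _ t) (i t a)
    _ ≤ κ * (par.α ^ t * V₀ + par.α ^ (t + 1) * V₀) := by
        rw [integral_const_mul, integral_add (hI t) (hI (t + 1))]
        exact mul_le_mul_of_nonneg_left (add_le_add (hE t) (hE (t + 1))) hκ0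
    _ ≤ κ * (par.α ^ t * V₀ + par.α ^ t * V₀) := by gcongr
    _ = _ := by ring

theorem ergodicMean_mem (hX : Convex ℝ X) (hα : 0 < par.α)
    (hM : IsProxMapping X h ω μ par.η M) (hx₀ : x₀ ∈ X)
    (hw₀ : IsSubgradientOn X ω x₀ w₀) (i : ℕ → Fin m) {k : ℕ} (hk : 1 ≤ k) :
    ergodicMean f' par M x₀ w₀ i k ∈ X := by
  refine hX.centerMass_mem (t := Finset.Icc 1 k) (w := fun t => (par.α ^ t)⁻¹)
    (z := fun t => (iterate f' par M x₀ w₀ i t).x) (fun t _ => by positivity) ?_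
    fun t _ => (isConsistent_iterate (f' := f') hM hx₀ hw₀ i t).mem
  exact Finset.sum_pos (fun t _ => by positivity) ⟨1, Finset.mem_Icc.2 ⟨le_rfl, hk⟩⟩

/-- Jensen's inequality along each sample path. -/
theorem gap_ergodicMean_le {Φ : E → ℝ} (hΦ : ConvexOn ℝ X Φ) (hα : 0 < par.α)
    (hM : IsProxMapping X h ω μ par.η M) (hx₀ : x₀ ∈ X)
    (hw₀ : IsSubgradientOn X ω x₀ w₀) (i : ℕ → Fin m) {k : ℕ} (hk : 1 ≤ k) (c : ℝ) :
    Φ (ergodicMean f' par M x₀ w₀ i k) - c ≤ (∑ t ∈ Finset.Icc 1 k, (par.α ^ t)⁻¹)⁻¹ *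
      ∑ t ∈ Finset.Icc 1 k, (par.α ^ t)⁻¹ * (Φ (iterate f' par M x₀ w₀ i t).x - c) := by
  have hW : 0 < ∑ t ∈ Finset.Icc 1 k, (par.α ^ t)⁻¹ :=
    Finset.sum_pos (fun t _ => by positivity) ⟨1, Finset.mem_Icc.2 ⟨le_rfl, hk⟩⟩
  have := hΦ.map_centerMass_le (t := Finset.Icc 1 k) (w := fun t => (par.α ^ t)⁻¹)
    (p := fun t => (iterate f' par M x₀ w₀ i t).x) (fun t _ => by positivity) hW
    fun t _ => (isConsistent_iterate (f' := f') hM hx₀ hw₀ i t).mem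
  simp only [Finset.centerMass, smul_eq_mul, Function.comp_apply] at this
  simp only [mul_sub, Finset.sum_sub_distrib, ← Finset.sum_mul]
  rw [← mul_assoc, inv_mul_cancel₀ hW.ne', one_mul]
  exact sub_le_sub_right this c

/-- The optimality gap of the ergodic mean in expectation. -/
theorem integral_gap_ergodicMean_le [IsProbabilityMeasure ν]
    (hP : IsCompositeMinimizer X h ω μ f f' L xs)
    (hpar : IsAdmissible par L μ) (hM : IsProxMapping X h ω μ par.η M) (hx₀ : x₀ ∈ X)
    (hw₀ : IsSubgradientOn X ω x₀ w₀) (hi : IsSampling ν par.p i) {σ : ℝ} (hσ : 0 ≤ σ)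
    (hL : ∑ i, L i ≤ σ ^ 2 * μ) {Φ : E → ℝ} (hΦ : ∀ x, Φ x = ∑ i, f i x + h x + μ * ω x)
    (hα : 1 / 2 ≤ par.α) {k : ℕ} (hk : 1 ≤ k) :
    ∫ a, (Φ (ergodicMean f' par M x₀ w₀ (fun t => i t a) k) - Φ xs) ∂ν ≤
      4 * (1 + σ ^ 2 + 13 * m * σ) * potential ω μ f f' par xs (initialState f' x₀ w₀)
        * (k * par.α ^ k) := by
  have hα0 : 0 < par.α := by linarith
  set V₀ := potential ω μ f f' par xs (initialState f' x₀ w₀) with hV₀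
  have hV₀0 : 0 ≤ V₀ := potential_nonneg hP hpar (isConsistent_initialState hx₀ hw₀)
  set κ := 1 + σ ^ 2 + 13 * m * σ with hκ
  have hκ0 : 0 ≤ κ := by positivity
  have hω : ConvexOn ℝ X ω := strongConvexOn_zero.1 (hP.strongConvexOn_ω.mono zero_le_one)
  have hX := hP.convexOn_h.1
  have hΦc : ConvexOn ℝ X Φ := by
    have h1 : ConvexOn ℝ X (∑ i, f i) :=
      Finset.sum_induction f (ConvexOn ℝ X) (fun _ _ ha hb => ha.add hb)
        (convexOn_const 0 hX) fun i _ => (hP.smooth i).convexOn hX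
    have h2 := (h1.add hP.convexOn_h).add (hω.smul hpar.μ_pos.le)
    refine h2.congr fun x _ => ?_
    simp [hΦ]
  set W := ∑ t ∈ Finset.Icc 1 k, (par.α ^ t)⁻¹ with hW
  -- Keeping only the last weight loses a factor of at most `k`, which the logarithm absorbs later.
  have hWk : (par.α ^ k)⁻¹ ≤ W :=
    Finset.single_le_sum (f := fun t => (par.α ^ t)⁻¹) (fun t _ => by positivity)
      (Finset.mem_Icc.2 ⟨hk, le_rfl⟩)
  have hW0 : 0 < W := lt_of_lt_of_le (by positivity) hWk
  have hWinv : W⁻¹ ≤ par.α ^ k := inv_le_of_inv_le₀ (by positivity) hWk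
  have hI := fun t => integrable_comp_iterate (f' := f') (M := M) (x₀ := x₀) (w₀ := w₀) hi
    (fun s => Φ s.x - Φ xs) t
  -- The weight cancels the geometric decay; the shift by one iteration costs `1/α ≤ 2`, turning
  -- `2κ` into `4κ`.
  have hterm : ∀ t ∈ Finset.Icc 1 k, ∫ a, (par.α ^ t)⁻¹ *
      (Φ (iterate f' par M x₀ w₀ (fun k => i k a) t).x - Φ xs) ∂ν ≤ 4 * κ * V₀ := by
    intro t ht
    obtain ⟨n, rfl⟩ : ∃ n, t = n + 1 := ⟨t - 1, by have := (Finset.mem_Icc.1 ht).1; omega⟩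
    rw [integral_const_mul]
    have := integral_gap_iterate_le hP hpar hM hx₀ hw₀ hi hσ hL hΦ n
    rw [inv_mul_le_iff₀ (by positivity)]
    refine this.trans ?_
    have h0 : 0 ≤ κ * V₀ * par.α ^ n := by positivity
    have e : par.α ^ (n + 1) = par.α ^ n * par.α := pow_succ _ _
    rw [e, ← hκ, ← hV₀]
    nlinarith
  calc ∫ a, (Φ (ergodicMean f' par M x₀ w₀ (fun t => i t a) k) - Φ xs) ∂ν
      ≤ ∫ a, W⁻¹ * ∑ t ∈ Finset.Icc 1 k, (par.α ^ t)⁻¹ *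
          (Φ (iterate f' par M x₀ w₀ (fun k => i k a) t).x - Φ xs) ∂ν := by
        refine integral_mono ?_ ?_ fun a => gap_ergodicMean_le hΦc hα0 hM hx₀ hw₀ _ hk _
        · exact hi.integrable (F := fun i => Φ (ergodicMean f' par M x₀ w₀ i k) - Φ xs)
            fun _ _ hab => congrArg (fun x => Φ x - Φ xs) (dependsOn_ergodicMean k hab)
        · exact (integrable_finsetSum _ fun t _ => (hI t).const_mul _).const_mul _
    _ = W⁻¹ * ∑ t ∈ Finset.Icc 1 k, ∫ a, (par.α ^ t)⁻¹ *
          (Φ (iterate f' par M x₀ w₀ (fun k => i k a) t).x - Φ xs) ∂ν := by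
        rw [integral_const_mul, integral_finsetSum _ fun t _ => (hI t).const_mul _]
    _ ≤ W⁻¹ * ∑ t ∈ Finset.Icc 1 k, 4 * κ * V₀ :=
        mul_le_mul_of_nonneg_left (Finset.sum_le_sum hterm) (by positivity)
    _ = 4 * κ * V₀ * (k * W⁻¹) := by
        rw [Finset.sum_const, Nat.card_Icc, nsmul_eq_mul, Nat.add_sub_cancel]
        ring
    _ ≤ _ := by gcongr

/-- The increment terms vanish as `x^{-1} = x^0`, and `L_i / p_i ≤ 2L` bounds the weighted Bregman
terms. -/
theorem potential_initialState_le (hP : IsCompositeMinimizer X h ω μ f f' L xs)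
    (hpar : IsAdmissible par L μ) (hx₀ : x₀ ∈ X) (hw₀ : IsSubgradientOn X ω x₀ w₀) :
    potential ω μ f f' par xs (initialState f' x₀ w₀) ≤
      (μ + par.η + 2 * m * (∑ i, L i) * (1 + par.τ)) * proxFun ω x₀ w₀ xs := by
  have hq := half_norm_sq_le_proxFun hP.strongConvexOn_ω hx₀ hw₀ hP.mem
  rw [norm_sub_rev] at hq
  have hτ := hpar.τ_pos
  have hQ0 : 0 ≤ proxFun ω x₀ w₀ xs := le_trans (by positivity) hq
  have hsum : ∑ i, (1 + par.τ) / par.p i * bregman (f i) (f' i) x₀ xs ≤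
      ∑ _i : Fin m, 2 * (∑ j, L j) * (1 + par.τ) * proxFun ω x₀ w₀ xs := by
    refine Finset.sum_le_sum fun i _ => ?_
    have hp := hpar.p_pos i
    have hL0 := (hP.smooth i).nonneg
    have h1 := (hP.smooth i).bregman_le x₀ xs
    have h2 : bregman (f i) (f' i) x₀ xs ≤ L i * proxFun ω x₀ w₀ xs := by nlinarith
    rw [div_mul_eq_mul_div, div_le_iff₀ hp]
    calc (1 + par.τ) * bregman (f i) (f' i) x₀ xs
        ≤ (1 + par.τ) * (L i * proxFun ω x₀ w₀ xs) := by gcongr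
      _ ≤ (1 + par.τ) * (2 * (∑ j, L j) * par.p i * proxFun ω x₀ w₀ xs) := by
        gcongr
        exact hpar.L_le i
      _ = _ := by ring
  rw [Finset.sum_const, Finset.card_univ, Fintype.card_fin, nsmul_eq_mul] at hsum
  simp only [potential, initialState, sub_self, map_zero, norm_zero]
  linarith

/-- With `T = m + 1 + S` one has `1 - α = 1/T`, `1 + τ = T/(2m)` and `μ + η = μT/2`. Hence
`(1-α)(1+τ) = 1/(2m) ≤ p_i` and `α(μ+η) = η + μ/2`, while `ητ = 8L` is a difference of squares in
the definition of `S`. -/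
theorem isAdmissible_nonuniformParameters (hm : 1 ≤ m) (hL : ∀ i, 0 ≤ L i)
    (hLt : 0 < ∑ i, L i) (hμ : 0 < μ) : IsAdmissible (nonuniformParameters L μ) L μ := by
  have hm' : (1 : ℝ) ≤ m := by exact_mod_cast hm
  have hm0 : (0 : ℝ) < m := by linarith
  set C : ℝ := 8 * (∑ i, L i) / μ with hC
  have hC0 : 0 < C := by positivity
  set S : ℝ := Real.sqrt (((m : ℝ) - 1) ^ 2 + 4 * m * C) with hS
  have hS2 : S ^ 2 = ((m : ℝ) - 1) ^ 2 + 4 * m * C := Real.sq_sqrt (by positivity)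
  have hSm : (m : ℝ) - 1 < S := by
    refine Real.lt_sqrt_of_sq_lt ?_
    have : 0 < 4 * m * C := by positivity
    linarith
  have hS0 : 0 < S := by linarith
  have hp : ∀ i, (nonuniformParameters L μ).p i = 1 / (2 * m) + L i / (2 * ∑ i, L i) :=
    fun _ => rfl
  have hτ : (nonuniformParameters L μ).τ = (S - ((m : ℝ) - 1)) / (2 * m) := rfl
  have hη : (nonuniformParameters L μ).η = (μ * S + μ * ((m : ℝ) - 1)) / 2 := rfl
  have hα : (nonuniformParameters L μ).α = 1 - 1 / (((m : ℝ) + 1) + S) := rfl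
  have hp1 : ∀ i, 1 / (2 * m) ≤ (nonuniformParameters L μ).p i := fun i => by
    rw [hp]
    have := hL i
    have : 0 ≤ L i / (2 * ∑ i, L i) := by positivity
    linarith
  constructor
  · exact hμ
  · exact fun i => lt_of_lt_of_le (by positivity) (hp1 i)
  · simp only [hp, Finset.sum_add_distrib, Finset.sum_const, Finset.card_univ, Fintype.card_fin,
      nsmul_eq_mul, ← Finset.sum_div]
    field_simp
    norm_num
  · intro i
    rw [hp]
    have e : 2 * (∑ i, L i) * (1 / (2 * m) + L i / (2 * ∑ i, L i)) = (∑ i, L i) / m + L i := by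
      field_simp
    rw [e]
    have : 0 ≤ (∑ i, L i) / m := by positivity
    linarith
  · intro i
    calc (1 : ℝ) = 2 * m * (1 / (2 * m)) := by field_simp
      _ ≤ _ := by
        gcongr
        exact hp1 i
  · rw [hτ]
    have : 0 < S - (m - 1) := by linarith
    positivity
  · rw [hη]
    have : 0 < μ * S := by positivity
    have : 0 ≤ μ * ((m : ℝ) - 1) := mul_nonneg hμ.le (by linarith)
    positivity
  · rw [hη, hτ]
    have e : (μ * S + μ * ((m : ℝ) - 1)) / 2 * ((S - ((m : ℝ) - 1)) / (2 * m)) =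
      μ * (S ^ 2 - ((m : ℝ) - 1) ^ 2) / (4 * m) := by
      field_simp
      ring
    rw [e, hS2, hC]
    field_simp
    ring
  · intro i
    refine le_trans (le_of_eq ?_) (hp1 i)
    rw [hα, hτ]
    have : (m : ℝ) + 1 + S ≠ 0 := by positivity
    field_simp
    ring
  · rw [hα, hη]
    have h1 : 0 < (m : ℝ) + 1 + S := by positivity
    have e : (1 - 1 / ((m : ℝ) + 1 + S)) * (μ + (μ * S + μ * ((m : ℝ) - 1)) / 2)
      = (μ * S + μ * ((m : ℝ) - 1)) / 2 + μ / 2 := by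
      field_simp
      ring
    rw [e]
    linarith
  · rw [hα, sub_nonneg, div_le_one (by positivity)]
    linarith
  · rw [hα]
    have : 0 ≤ 1 / ((m : ℝ) + 1 + S) := by positivity
    linarith

end Convergence

end StructuredRPDG

namespace StructuredRPDG

/-! ### Numerical estimates for the iteration count. -/

section Numeric

/-- Half of the exponential `e^{-k/T}` absorbs the factor `k`. -/
theorem nat_mul_one_sub_inv_pow_le {T : ℝ} (hT : 1 ≤ T) (k : ℕ) :
    k * (1 - 1 / T) ^ k ≤ 2 * T * Real.exp (-(k / (2 * T))) := by
  have hT0 : 0 < T := by linarith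
  have h1 : (1 - 1 / T) ^ k ≤ Real.exp (-(k / (2 * T))) * Real.exp (-(k / (2 * T))) := by
    have h2 : 1 - 1 / T ≤ Real.exp (-(1 / T)) := Real.one_sub_le_exp_neg _
    have h3 : 0 ≤ 1 - 1 / T := by
      rw [sub_nonneg, div_le_one hT0]
      exact hT
    calc (1 - 1 / T) ^ k ≤ Real.exp (-(1 / T)) ^ k := by gcongr
      _ = _ := by
        rw [← Real.exp_nat_mul, ← Real.exp_add]
        congr 1
        field_simp
        ring
  have h4 : (k : ℝ) * Real.exp (-(k / (2 * T))) ≤ 2 * T := by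
    have h5 := Real.add_one_le_exp ((k : ℝ) / (2 * T))
    have h6 : (k : ℝ) / (2 * T) ≤ Real.exp (k / (2 * T)) := by linarith
    rw [div_le_iff₀ (by positivity)] at h6
    rw [Real.exp_neg, ← div_eq_mul_inv, div_le_iff₀ (Real.exp_pos _)]
    linarith
  calc k * (1 - 1 / T) ^ k
      ≤ k * (Real.exp (-(k / (2 * T))) * Real.exp (-(k / (2 * T)))) := by gcongr
    _ = k * Real.exp (-(k / (2 * T))) * Real.exp (-(k / (2 * T))) := by ring
    _ ≤ _ := by gcongr

/-- The threshold on `k` yields `(λ/N)^28`. Six powers of `N` cancel `N^5` and `T ≤ 19 N`; the other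
22 beat the constants because `N ≥ 2`. -/
theorem linear_rate_le {N T lam : ℝ} (hN : 2 ≤ N) (hT : 1 ≤ T) (hTN : T ≤ 19 * N) (hl : 0 < lam)
    (hl1 : lam ≤ 1) {k : ℕ} (hk : 56 * T * Real.log (N / lam) ≤ k) :
    14700 * N ^ 5 * (k * (1 - 1 / T) ^ k) ≤ lam / 4 := by
  have hN0 : 0 < N := by linarith
  have hT0 : 0 < T := by linarith
  have hexp : Real.exp (-(k / (2 * T))) ≤ (lam / N) ^ 28 := by
    have h1 : 28 * Real.log (N / lam) ≤ k / (2 * T) := by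
      rw [le_div_iff₀ (by positivity)]
      linarith
    have h2 : (lam / N) ^ 28 = Real.exp (-(28 * Real.log (N / lam))) := by
      rw [← Real.exp_log (show 0 < lam / N by positivity), ← Real.exp_nat_mul, ← inv_div,
        Real.log_inv]
      congr 1
      push_cast
      ring
    rw [h2]
    exact Real.exp_le_exp.2 (by linarith)
  have hpow : (lam / N) ^ 28 ≤ lam / (4194304 * N ^ 6) := by
    rw [div_pow]
    have h1 : lam ^ 28 ≤ lam := pow_le_of_le_one hl.le hl1 (by norm_num)
    have h2 : 4194304 * N ^ 6 ≤ N ^ 28 := by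
      have : (2 : ℝ) ^ 22 ≤ N ^ 22 := by gcongr
      calc 4194304 * N ^ 6 = 2 ^ 22 * N ^ 6 := by norm_num
        _ ≤ N ^ 22 * N ^ 6 := by gcongr
        _ = N ^ 28 := by ring
    gcongr
  calc 14700 * N ^ 5 * (k * (1 - 1 / T) ^ k)
      ≤ 14700 * N ^ 5 * (2 * (19 * N) * (lam / (4194304 * N ^ 6))) := by
        refine mul_le_mul_of_nonneg_left ((nat_mul_one_sub_inv_pow_le hT k).trans ?_)
          (by positivity)
        gcongr
        exact hexp.trans hpow
    _ = (558600 / 4194304) * lam := by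
      field_simp
      norm_num
    _ ≤ lam / 4 := by linarith

/-- The number of iterations is of the order that the complexity bounds allow. -/
theorem iteration_count_le {m : ℕ} (hm : 1 ≤ m) {R T lam : ℝ} (hR : 0 < R) (hl : 0 < lam)
    (hl1 : lam ≤ 1) (hT1 : 0 ≤ T) (hT : T ≤ 2 * m + 16 * (Real.sqrt m * R)) :
    ∃ K : ℕ, 1 ≤ K ∧ 56 * T * Real.log (m * (2 + R) / lam) ≤ K ∧
      (K : ℝ) ≤ 3000 * ((m + Real.sqrt m * R) * Real.log (m * (2 + R) / lam)) ∧
      (2 * Real.sqrt m ≤ R →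
        (K : ℝ) ≤ 3000 * (Real.sqrt m * R * Real.log (m * R / lam))) := by
  have hm' : (1 : ℝ) ≤ m := by exact_mod_cast hm
  have hm0 : (0 : ℝ) < m := by linarith
  set r : ℝ := Real.sqrt m with hr
  have hr1 : 1 ≤ r := Real.one_le_sqrt.2 hm'
  have hrr : r * r = m := Real.mul_self_sqrt hm0.le
  have h2 : 2 ≤ m * (2 + R) / lam := by
    rw [le_div_iff₀ hl]
    nlinarith [mul_pos hm0 hR]
  set l : ℝ := Real.log (m * (2 + R) / lam) with hldef
  have hlog : 1 / 2 ≤ l := by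
    have : Real.log 2 ≤ l := Real.log_le_log (by norm_num) h2
    linarith [Real.log_two_gt_d9]
  set Q : ℝ := m + r * R with hQ
  have hQ1 : 1 ≤ Q := by
    have : 0 < r * R := by positivity
    linarith
  have hTl : 56 * T * l ≤ 896 * (Q * l) := by
    have : T ≤ 16 * Q := by linarith
    nlinarith
  have hQl : 1 ≤ 2 * (Q * l) := by nlinarith
  -- `56 · 16 = 896` comes from `T ≤ 16 Q`; rounding and the extra `1` add at most `2 ≤ 4 Q l`.
  have hK : (⌈56 * T * l⌉₊ + 1 : ℝ) ≤ 900 * (Q * l) := by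
    have := Nat.ceil_lt_add_one (show 0 ≤ 56 * T * l by positivity)
    linarith
  refine ⟨⌈56 * T * l⌉₊ + 1, by omega, ?_, ?_, fun hRm => ?_⟩
  · push_cast
    linarith [Nat.le_ceil (56 * T * l)]
  · push_cast
    linarith
  · push_cast
    have hR2 : 2 ≤ R := by linarith
    have hmR : (m : ℝ) ≤ r * R / 2 := by
      rw [← hrr]
      nlinarith
    -- For `R ≥ 2√m` the logarithm doubles and `Q ≤ (3/2) √m R`, so the constant grows from 900 to
    -- 2700.
    have hll : l ≤ 2 * Real.log (m * R / lam) := by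
      have e : 2 * Real.log (m * R / lam) = Real.log ((m * R / lam) ^ 2) := by
        rw [Real.log_pow]
        norm_num
      rw [hldef, e]
      refine Real.log_le_log (by positivity) ?_
      have h3 : (m : ℝ) * (2 + R) ≤ (m * R) * (m * R) := by
        have : 2 ≤ m * R := by nlinarith
        have : (m : ℝ) * (2 + R) ≤ 2 * (m * R) := by nlinarith
        nlinarith
      rw [div_pow, div_le_div_iff₀ hl (by positivity)]
      have h4 : lam ^ 2 ≤ lam := pow_le_of_le_one hl.le hl1 (by norm_num)
      calc (m : ℝ) * (2 + R) * lam ^ 2 ≤ (m * R) * (m * R) * lam := by gcongr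
        _ = _ := by ring
    have hL0 : 0 ≤ Real.log (m * R / lam) := by linarith
    have hrR : 0 ≤ r * R := by positivity
    have hQr : Q ≤ 3 / 2 * (r * R) := by linarith
    calc (⌈56 * T * l⌉₊ + 1 : ℝ) ≤ 900 * (Q * l) := hK
      _ ≤ 900 * (3 / 2 * (r * R) * (2 * Real.log (m * R / lam))) := by gcongr
      _ ≤ _ := by nlinarith [mul_nonneg hrR hL0]

/-- Bounds on the stepsizes in terms of the number of components and of `R`, where `8 R²` is the
condition number. -/
theorem nonuniformParameters_bounds {m : ℕ} (hm : 1 ≤ m) {L : Fin m → ℝ} {μ R : ℝ} (hμ : 0 < μ)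
    (hR : 0 < R) (hL : ∑ i, L i = 8 * R ^ 2 * μ) :
    ∃ T : ℝ, 2 ≤ T ∧ T ≤ 2 * m + 16 * (Real.sqrt m * R) ∧ T ≤ 19 * (m * (2 + R)) ∧
      (nonuniformParameters L μ).α = 1 - 1 / T ∧
      μ + (nonuniformParameters L μ).η
        + 2 * m * (∑ i, L i) * (1 + (nonuniformParameters L μ).τ)
        ≤ μ * (300 * (m * (2 + R)) ^ 3) := by
  have hm' : (1 : ℝ) ≤ m := by exact_mod_cast hm
  set S : ℝ := Real.sqrt (((m : ℝ) - 1) ^ 2 + 4 * m * (8 * (∑ i, L i) / μ)) with hS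
  have hτ : (nonuniformParameters L μ).τ = (S - ((m : ℝ) - 1)) / (2 * m) := rfl
  have hη : (nonuniformParameters L μ).η = (μ * S + μ * ((m : ℝ) - 1)) / 2 := rfl
  have hα : (nonuniformParameters L μ).α = 1 - 1 / (((m : ℝ) + 1) + S) := rfl
  have hS' : S = Real.sqrt (((m : ℝ) - 1) ^ 2 + 256 * (m * R ^ 2)) := by
    rw [hS, hL]
    congr 1
    field_simp
    ring
  have hS0 : 0 ≤ S := Real.sqrt_nonneg _
  have hSm : (m : ℝ) - 1 ≤ S := by
    rw [hS']
    exact Real.le_sqrt_of_sq_le (by nlinarith [mul_nonneg (by linarith : (0 : ℝ) ≤ m) (sq_nonneg R)])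
  have hSle : S ≤ (m - 1) + 16 * (Real.sqrt m * R) := by
    rw [hS']
    refine Real.sqrt_le_iff.2 ⟨?_, ?_⟩
    · have : 0 ≤ Real.sqrt m * R := by positivity
      linarith
    · have h1 : (Real.sqrt m * R) ^ 2 = m * R ^ 2 := by
        rw [mul_pow, Real.sq_sqrt (by positivity)]
      have h2 : 0 ≤ (m - 1) * (Real.sqrt m * R) := mul_nonneg (by linarith) (by positivity)
      nlinarith
  set N : ℝ := m * (2 + R) with hN
  have hmN : (m : ℝ) ≤ N := by nlinarith
  have hN2 : 2 ≤ N := by nlinarith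
  have hmR : m * R ≤ N := by nlinarith
  have hsm : Real.sqrt m * R ≤ N := by
    have h1 : Real.sqrt m ≤ m := Real.sqrt_le_iff.2 ⟨by positivity, by nlinarith⟩
    have : Real.sqrt m * R ≤ m * R := by gcongr
    linarith
  refine ⟨(m : ℝ) + 1 + S, by linarith, by linarith, by linarith, hα, ?_⟩
  have hS18 : S ≤ 17 * N - 1 := by linarith
  have hη9 : (nonuniformParameters L μ).η ≤ μ * (9 * N - 1) := by
    rw [hη, ← mul_add, mul_div_assoc]
    exact mul_le_mul_of_nonneg_left (by linarith) hμ.le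
  have hτ18 : 1 + (nonuniformParameters L μ).τ ≤ 18 * N := by
    have h1 : (nonuniformParameters L μ).τ ≤ S := by
      rw [hτ, div_le_iff₀ (by positivity)]
      nlinarith
    linarith
  have hmR2 : m * R ^ 2 ≤ N ^ 2 := by
    have : m * R ^ 2 ≤ (m * R) ^ 2 := by
      rw [mul_pow]
      gcongr
      nlinarith
    exact this.trans (by gcongr)
  have h1 : 2 * m * (∑ i, L i) * (1 + (nonuniformParameters L μ).τ) ≤ μ * (288 * N ^ 3) := by
    calc 2 * m * (∑ i, L i) * (1 + (nonuniformParameters L μ).τ)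
        = 16 * μ * (m * R ^ 2) * (1 + (nonuniformParameters L μ).τ) := by rw [hL]; ring
      _ ≤ 16 * μ * N ^ 2 * (18 * N) := by
        refine mul_le_mul (by gcongr) hτ18 ?_ (by positivity)
        rw [hτ]
        have : 0 ≤ S - (m - 1) := by linarith
        positivity
      _ = _ := by ring
  have h2 : 9 * N ≤ 12 * N ^ 3 := by
    have : 4 ≤ N ^ 2 := by nlinarith
    nlinarith
  have h3 := mul_le_mul_of_nonneg_left h2 hμ.le
  linarith

theorem one_add_sq_add_le {m R : ℝ} (hm : 1 ≤ m) (hR : 0 ≤ R) :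
    1 + (3 * R) ^ 2 + 13 * m * (3 * R) ≤ 49 * (m * (2 + R)) ^ 2 := by
  have h0 : R ≤ m * R := le_mul_of_one_le_left hR hm
  have h2 : R ^ 2 ≤ (m * (2 + R)) ^ 2 := by
    gcongr
    linarith
  have h4 : 1 ≤ m * (2 + R) := by linarith
  have h5 : m * (2 + R) ≤ (m * (2 + R)) ^ 2 := le_self_pow₀ h4 two_ne_zero
  have h6 : m * R ≤ m * (2 + R) := by linarith
  rw [mul_pow]
  linarith

end Numeric

/-! ### The smoothed and perturbed problem. -/

namespace Problem

open Set MeasureTheory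

variable {m : ℕ} {E : Type u} [NormedAddCommGroup E] [NormedSpace ℝ E]
  {F : Fin m → Type v} [∀ i, NormedAddCommGroup (F i)] [∀ i, NormedSpace ℝ (F i)]
  (P : Problem m E F) {ε : ℝ}

theorem isCompact_X [FiniteDimensional ℝ E] : IsCompact P.X := by
  have := FiniteDimensional.proper_real E
  refine Metric.isCompact_of_isClosed_isBounded P.isClosed_X ?_
  refine (Metric.isBounded_closedBall (x := P.x₀) (r := Real.sqrt (2 * P.ΩX ^ 2))).subset ?_
  intro x hx
  rw [Metric.mem_closedBall, dist_eq_norm]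
  refine Real.le_sqrt_of_sq_le ?_
  have h1 := half_norm_sq_le_proxFun P.strongConvexOn_ω P.x₀_mem P.w₀_subgradient hx
  have h2 := P.proxFun_le x hx
  linarith

theorem isCompact_Y (i : Fin m) [FiniteDimensional ℝ (F i)] : IsCompact (P.Y i) := by
  have := FiniteDimensional.proper_real (F i)
  exact Metric.isCompact_of_isClosed_isBounded (P.isClosed_Y i)
    ((P.strongConvexOn_v i).isBounded_of_bounds (P.v_nonneg i) (P.v_le i))

theorem convexOn_ω : ConvexOn ℝ P.X P.ω :=
  strongConvexOn_zero.1 (P.strongConvexOn_ω.mono zero_le_one)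

theorem normA_nonneg : 0 ≤ P.normA := Real.sqrt_nonneg _

theorem ΩY_nonneg : 0 ≤ P.ΩY := Real.sqrt_nonneg _

variable {P}

theorem pos_of_mul_pos (hpos : 0 < P.normA * P.ΩX * P.ΩY) :
    0 < P.normA ∧ 0 < P.ΩX ∧ 0 < P.ΩY := by
  refine ⟨P.normA_nonneg.lt_of_ne' ?_, P.ΩX_nonneg.lt_of_ne' ?_, P.ΩY_nonneg.lt_of_ne' ?_⟩ <;>
  · intro h
    rw [h] at hpos
    simp at hpos

theorem one_le_of_normA_pos (h : 0 < P.normA) : 1 ≤ m := by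
  rcases Nat.eq_zero_or_pos m with rfl | hm
  · simp [normA] at h
  · exact hm

theorem smoothingParam_pos (hε : 0 < ε) (hY : 0 < P.ΩY) : 0 < P.smoothingParam ε := by
  unfold smoothingParam
  positivity

theorem perturbParam_pos (hε : 0 < ε) (hX : 0 < P.ΩX) : 0 < P.perturbParam ε := by
  unfold perturbParam
  positivity

theorem strongConvexOn_smoothing (i : Fin m) {δ : ℝ} (hδ : 0 ≤ δ) :
    StrongConvexOn (P.Y i) δ (fun y => P.q i y + δ * P.v i y) := by
  refine ⟨P.convex_Y i, fun x hx y hy a b ha hb hab => ?_⟩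
  have h1 := (P.convexOn_q i).2 hx hy ha hb hab
  have h2 := (P.strongConvexOn_v i).2 hx hy ha hb hab
  simp only [smul_eq_mul] at h1 h2 ⊢
  have h3 := mul_le_mul_of_nonneg_left h2 hδ
  linarith

theorem lsc_smoothing (i : Fin m) {δ : ℝ} (hδ : 0 ≤ δ) :
    LowerSemicontinuousOn (fun y => P.q i y + δ * P.v i y) (P.Y i) :=
  (P.lsc_q i).add ((continuous_const_mul δ).comp_lowerSemicontinuousOn (P.lsc_v i)
    (monotone_mul_left_of_nonneg hδ))

theorem isSmoothConvex_smoothed [∀ i, FiniteDimensional ℝ (F i)]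
    (hδ : 0 < P.smoothingParam ε) (i : Fin m) :
    IsSmoothConvex (P.smoothed ε i) (fun x => fderiv ℝ (P.smoothed ε i) x)
      (‖P.A i‖ ^ 2 / P.smoothingParam ε) := by
  obtain ⟨f', hf'⟩ := exists_isSmoothConvex_maxFun (P.A i) (P.isCompact_Y i) (P.nonempty_Y i) hδ
    (strongConvexOn_smoothing i hδ.le) (lsc_smoothing i hδ.le)
  have h : IsSmoothConvex (P.smoothed ε i) f' (‖P.A i‖ ^ 2 / P.smoothingParam ε) := hf'
  rw [← h.fderiv_eq] at h
  exact h

theorem smoothed_le [∀ i, FiniteDimensional ℝ (F i)] (hδ : 0 < P.smoothingParam ε) (i : Fin m)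
    (x : E) : P.smoothed ε i x ≤ maxFun (P.A i) (P.Y i) (P.q i) x := by
  refine maxFun_le _ (P.nonempty_Y i) x fun y hy => ?_
  have h1 := le_maxFun (P.A i) (P.isCompact_Y i) (P.nonempty_Y i) (P.convexOn_q i) (P.lsc_q i) x hy
  have h2 := mul_nonneg hδ.le (P.v_nonneg i y hy)
  linarith

theorem le_smoothed_add [∀ i, FiniteDimensional ℝ (F i)] (hδ : 0 < P.smoothingParam ε) (i : Fin m)
    (x : E) : maxFun (P.A i) (P.Y i) (P.q i) x ≤
      P.smoothed ε i x + P.smoothingParam ε * P.ΩYi i ^ 2 := by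
  refine maxFun_le _ (P.nonempty_Y i) x fun y hy => ?_
  have h1 : P.A i x y - (P.q i y + P.smoothingParam ε * P.v i y) ≤ P.smoothed ε i x :=
    le_maxFun (P.A i) (P.isCompact_Y i) (P.nonempty_Y i)
      (strongConvexOn_zero.1 ((strongConvexOn_smoothing i hδ.le).mono hδ.le))
      (lsc_smoothing i hδ.le) x hy
  have h2 := mul_le_mul_of_nonneg_left (P.v_le i y hy) hδ.le
  linarith

variable (P) (ε) in
/-- The objective of the smoothed and perturbed problem. -/
noncomputable def smoothedObjective (x : E) : ℝ :=
  ∑ i, P.smoothed ε i x + P.hPert ε x + P.perturbParam ε * P.ω x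

theorem smoothedObjective_eq (x : E) : P.smoothedObjective ε x =
    ∑ i, P.smoothed ε i x + P.h x + P.perturbParam ε * proxFun P.ω P.x₀ P.w₀ x := by
  unfold smoothedObjective hPert proxFun
  ring

theorem convexOn_hPert : ConvexOn ℝ P.X (P.hPert ε) := by
  refine ⟨P.convex_X, fun x hx y hy a b ha hb hab => ?_⟩
  have h1 := P.convexOn_h.2 hx hy ha hb hab
  obtain rfl : b = 1 - a := by linarith
  simp only [hPert, smul_eq_mul, map_sub, map_add, map_smul] at h1 ⊢
  linarith

theorem lsc_hPert : LowerSemicontinuousOn (P.hPert ε) P.X := by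
  have hc : Continuous fun x => -(P.perturbParam ε * (P.ω P.x₀ + P.w₀ (x - P.x₀))) := by fun_prop
  have e : P.hPert ε =
      fun x => P.h x + -(P.perturbParam ε * (P.ω P.x₀ + P.w₀ (x - P.x₀))) := by
    funext x
    rw [hPert, sub_eq_add_neg]
  rw [e]
  exact P.lsc_h.add (hc.lowerSemicontinuous.lowerSemicontinuousOn _)

theorem exists_isCompositeMinimizer [FiniteDimensional ℝ E] [∀ i, FiniteDimensional ℝ (F i)]
    (hδ : 0 < P.smoothingParam ε) (hμ : 0 < P.perturbParam ε) :
    ∃ xs, IsCompositeMinimizer P.X (P.hPert ε) P.ω (P.perturbParam ε) (P.smoothed ε)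
      (fun i x => fderiv ℝ (P.smoothed ε i) x) (fun i => ‖P.A i‖ ^ 2 / P.smoothingParam ε) xs := by
  have hsm := isSmoothConvex_smoothed (P := P) hδ
  have hc : Continuous fun x => ∑ i, P.smoothed ε i x :=
    continuous_finsetSum _ fun i _ =>
      continuous_iff_continuousAt.2 fun x => ((hsm i).hasFDerivAt x).continuousAt
  have hlsc : LowerSemicontinuousOn (P.smoothedObjective ε) P.X :=
    ((hc.lowerSemicontinuous.lowerSemicontinuousOn _).add lsc_hPert).add
      ((continuous_const_mul _).comp_lowerSemicontinuousOn P.lsc_ω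
        (monotone_mul_left_of_nonneg hμ.le))
  obtain ⟨xs, hxs, hmin⟩ := LowerSemicontinuousOn.exists_isMinOn ⟨_, P.x₀_mem⟩ P.isCompact_X hlsc
  exact ⟨xs, convexOn_hPert, P.strongConvexOn_ω, hsm, hxs, hmin⟩

/-- The error `3ε/4` is `ε/4` from the prox term at a competitor plus `ε/2` from smoothing at `x`;
nonnegativity of `v_i` and of the prox-function makes the other two comparisons free. -/
theorem gap_le_smoothedObjective_gap [∀ i, FiniteDimensional ℝ (F i)] (hε : 0 < ε)
    (hX : 0 < P.ΩX) (hY : 0 < P.ΩY) {xs : E} (hmin : IsMinOn (P.smoothedObjective ε) P.X xs)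
    {x : E} (hx : x ∈ P.X) :
    P.Ψ x - P.Ψopt ≤ P.smoothedObjective ε x - P.smoothedObjective ε xs + 3 * ε / 4 := by
  have hδ := smoothingParam_pos hε hY
  have hμ := perturbParam_pos hε hX
  have hμX : P.perturbParam ε * P.ΩX ^ 2 = ε / 4 := by
    unfold perturbParam
    field_simp
    norm_num
  have hδY : P.smoothingParam ε * P.ΩY ^ 2 = ε / 2 := by
    unfold smoothingParam
    field_simp
  -- A lower bound over all competitors suffices, so a minimizer of `Ψ` is not needed.
  have hopt : P.smoothedObjective ε xs - ε / 4 ≤ P.Ψopt := by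
    refine le_csInf ⟨_, P.x₀, P.x₀_mem, rfl⟩ ?_
    rintro _ ⟨z, hz, rfl⟩
    have h1 : P.smoothedObjective ε xs ≤ P.smoothedObjective ε z := hmin hz
    have h2 := mul_le_mul_of_nonneg_left (P.proxFun_le z hz) hμ.le
    have h3 := Finset.sum_le_sum fun i (_ : i ∈ Finset.univ) => smoothed_le hδ i z
    rw [smoothedObjective_eq (x := z)] at h1
    rw [Ψ]
    linarith
  have h1 := Finset.sum_le_sum fun i (_ : i ∈ Finset.univ) => le_smoothed_add hδ i x
  rw [Finset.sum_add_distrib, ← Finset.mul_sum] at h1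
  have h2 : ∑ i, P.ΩYi i ^ 2 = P.ΩY ^ 2 :=
    (Real.sq_sqrt (Finset.sum_nonneg fun i _ => sq_nonneg _)).symm
  rw [h2, hδY] at h1
  have h3 : 0 ≤ P.perturbParam ε * proxFun P.ω P.x₀ P.w₀ x :=
    mul_nonneg hμ.le (le_trans (by positivity)
      (half_norm_sq_le_proxFun P.strongConvexOn_ω P.x₀_mem P.w₀_subgradient hx))
  rw [smoothedObjective_eq (x := x), Ψ]
  linarith

theorem sum_lipschitz_eq (hε : 0 < ε) (hX : 0 < P.ΩX) (hY : 0 < P.ΩY) :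
    ∑ i, ‖P.A i‖ ^ 2 / P.smoothingParam ε = 8 * P.ratio ε ^ 2 * P.perturbParam ε := by
  have h : ∑ i, ‖P.A i‖ ^ 2 = P.normA ^ 2 :=
    (Real.sq_sqrt (Finset.sum_nonneg fun i _ => sq_nonneg _)).symm
  rw [← Finset.sum_div, h, smoothingParam, ratio, perturbParam]
  field_simp
  norm_num

/-- The optimality gap of the smoothed and perturbed problem in expectation, in terms of the scale
invariant ratio. -/
theorem integral_smoothedObjective_gap_le [∀ i, FiniteDimensional ℝ (F i)] (hε : 0 < ε)
    (hpos : 0 < P.normA * P.ΩX * P.ΩY) {xs : E}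
    (hxs : IsCompositeMinimizer P.X (P.hPert ε) P.ω (P.perturbParam ε) (P.smoothed ε)
      (fun i x => fderiv ℝ (P.smoothed ε i) x) (fun i => ‖P.A i‖ ^ 2 / P.smoothingParam ε) xs) :
    ∃ T : ℝ, 0 ≤ T ∧ T ≤ 2 * m + 16 * (Real.sqrt m * P.ratio ε) ∧
      0 < (P.parameters ε).α ∧
      ∀ lam : ℝ, 0 < lam → lam ≤ 1 → ∀ M, P.IsProx ε M →
        ∀ (Ω : Type w) [MeasurableSpace Ω] (ν : Measure Ω) [IsProbabilityMeasure ν]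
          (i : ℕ → Ω → Fin m), IsSampling ν (P.parameters ε).p i →
        ∀ k : ℕ, 1 ≤ k → 56 * T * Real.log (m * (2 + P.ratio ε) / lam) ≤ k →
          ∫ a, (P.smoothedObjective ε (P.output ε M (fun t => i t a) k)
            - P.smoothedObjective ε xs) ∂ν ≤ ε * (lam / 4) := by
  obtain ⟨hA, hX, hY⟩ := pos_of_mul_pos hpos
  have hm := one_le_of_normA_pos hA
  have hm' : (1 : ℝ) ≤ m := by exact_mod_cast hm
  have hδ := smoothingParam_pos hε hY
  have hμ := perturbParam_pos hε hX
  have hR : 0 < P.ratio ε := div_pos hpos hε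
  have hLt := sum_lipschitz_eq hε hX hY
  have hLpos : 0 < ∑ i, ‖P.A i‖ ^ 2 / P.smoothingParam ε := by
    rw [hLt]
    positivity
  have hpar : IsAdmissible (P.parameters ε) (fun i => ‖P.A i‖ ^ 2 / P.smoothingParam ε)
      (P.perturbParam ε) :=
    isAdmissible_nonuniformParameters hm (fun i => by positivity) hLpos hμ
  obtain ⟨T, hT2, hT, hTN, hα, hcoef⟩ := nonuniformParameters_bounds hm hμ hR hLt
  have hα' : (P.parameters ε).α = 1 - 1 / T := hα
  have hα2 : 1 / 2 ≤ (P.parameters ε).α := by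
    rw [hα']
    have : 1 / T ≤ 1 / 2 := one_div_le_one_div_of_le (by norm_num) hT2
    linarith
  refine ⟨T, by linarith, hT, by linarith, fun lam hl hl1 M hM Ω _ ν _ i hi k hk1 hk => ?_⟩
  -- `σ = 3R` works because `8 ≤ 9`.
  have hσL : ∑ i, ‖P.A i‖ ^ 2 / P.smoothingParam ε ≤
      (3 * P.ratio ε) ^ 2 * P.perturbParam ε := by
    rw [hLt, mul_pow]
    gcongr
    norm_num
  have hmain := integral_gap_ergodicMean_le hxs hpar hM P.x₀_mem P.w₀_subgradient hi
    (by positivity) hσL (Φ := P.smoothedObjective ε) (fun x => rfl) hα2 hk1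
  refine hmain.trans ?_
  have hV := (potential_initialState_le hxs hpar P.x₀_mem P.w₀_subgradient).trans
    (mul_le_mul hcoef (P.proxFun_le xs hxs.mem) (le_trans (by positivity)
      (half_norm_sq_le_proxFun P.strongConvexOn_ω P.x₀_mem P.w₀_subgradient hxs.mem))
      (by positivity))
  have hV0 := potential_nonneg hxs hpar
    (isConsistent_initialState P.x₀_mem P.w₀_subgradient)
  have hμX : P.perturbParam ε * P.ΩX ^ 2 = ε / 4 := by
    rw [perturbParam]
    field_simp
    norm_num
  have hα0 : 0 ≤ (P.parameters ε).α := by linarith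
  rw [hα'] at hα0 ⊢
  generalize potential P.ω (P.perturbParam ε) (P.smoothed ε)
    (fun i x => fderiv ℝ (P.smoothed ε i) x) (P.parameters ε) xs
    (initialState (fun i x => fderiv ℝ (P.smoothed ε i) x) P.x₀ P.w₀) = V₀ at hV hV0 ⊢
  generalize P.ratio ε = R at *
  have hN2 : 2 ≤ m * (2 + R) := by nlinarith
  have hrate := linear_rate_le hN2 (by linarith) hTN hl hl1 hk
  have hκ := one_add_sq_add_le hm' hR.le
  have hV75 : V₀ ≤ 75 * (m * (2 + R)) ^ 3 * ε := by
    refine hV.trans_eq ?_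
    calc P.perturbParam ε * (300 * (m * (2 + R)) ^ 3) * P.ΩX ^ 2
        = 300 * (m * (2 + R)) ^ 3 * (P.perturbParam ε * P.ΩX ^ 2) := by ring
      _ = _ := by rw [hμX]; ring
  generalize (m : ℝ) * (2 + R) = N at *
  -- Here `14700 = 4 · 49 · 75`: Jensen step, gap constant, initial potential.
  calc 4 * (1 + (3 * R) ^ 2 + 13 * m * (3 * R)) * V₀ * (k * (1 - 1 / T) ^ k)
      ≤ 4 * (49 * N ^ 2) * (75 * N ^ 3 * ε) * (k * (1 - 1 / T) ^ k) := by gcongr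
    _ = ε * (14700 * N ^ 5 * (k * (1 - 1 / T) ^ k)) := by ring
    _ ≤ ε * (lam / 4) := by gcongr

end Problem

end StructuredRPDG

/-! ### Well-definedness and the complexity bounds. -/

namespace StructuredRPDG.Problem

open MeasureTheory

variable {m : ℕ} {E : Type u} [NormedAddCommGroup E] [NormedSpace ℝ E] [FiniteDimensional ℝ E]
  {F : Fin m → Type v} [∀ i, NormedAddCommGroup (F i)] [∀ i, NormedSpace ℝ (F i)]
  {P : Problem m E F} {ε : ℝ}

theorem exists_isProx (hε : 0 < ε) (hpos : 0 < P.normA * P.ΩX * P.ΩY) : ∃ M, P.IsProx ε M := by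
  obtain ⟨hA, hX, hY⟩ := pos_of_mul_pos hpos
  have hδ := smoothingParam_pos hε hY
  have hμ := perturbParam_pos hε hX
  have hR : 0 < P.ratio ε := div_pos hpos hε
  have hpar : IsAdmissible (P.parameters ε) (fun i => ‖P.A i‖ ^ 2 / P.smoothingParam ε)
      (P.perturbParam ε) := by
    refine isAdmissible_nonuniformParameters (one_le_of_normA_pos hA) (fun i => by positivity) ?_ hμ
    rw [sum_lipschitz_eq hε hX hY]
    positivity
  exact exists_isProxMapping P.isCompact_X convexOn_hPert lsc_hPert P.convexOn_ω P.lsc_ω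
    (add_pos hμ hpar.η_pos)

/-- Both complexity bounds at once: after `K` iterations the output is feasible, and its optimality
gap is at most `3 ε / 4` plus a nonnegative quantity with expectation at most `ε lam / 4`. -/
theorem exists_iteration_bound [∀ i, FiniteDimensional ℝ (F i)] (hε : 0 < ε)
    (hpos : 0 < P.normA * P.ΩX * P.ΩY) {lam : ℝ}
    (hl : 0 < lam) (hl1 : lam ≤ 1) :
    ∃ K : ℕ, 1 ≤ K ∧
      (K : ℝ) ≤
        3000 * ((m + Real.sqrt m * P.ratio ε) * Real.log (m * (2 + P.ratio ε) / lam)) ∧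
      (2 * Real.sqrt m ≤ P.ratio ε →
        (K : ℝ) ≤ 3000 * (Real.sqrt m * P.ratio ε * Real.log (m * P.ratio ε / lam))) ∧
      ∀ M, P.IsProx ε M →
      ∀ (Ω : Type w) [MeasurableSpace Ω] (ν : Measure Ω) [IsProbabilityMeasure ν]
        (i : ℕ → Ω → Fin m), IsSampling ν (P.parameters ε).p i →
      ∀ k : ℕ, K ≤ k → (∀ a, P.output ε M (fun t => i t a) k ∈ P.X) ∧
        Integrable (fun a => P.Ψ (P.output ε M (fun t => i t a) k) - P.Ψopt) ν ∧
        ∃ gap : Ω → ℝ, Integrable gap ν ∧ (∀ a, 0 ≤ gap a) ∧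
          (∀ a, P.Ψ (P.output ε M (fun t => i t a) k) - P.Ψopt ≤ gap a + 3 * ε / 4) ∧
          ∫ a, gap a ∂ν ≤ ε * (lam / 4) := by
  obtain ⟨hA, hX, hY⟩ := pos_of_mul_pos hpos
  have hR : 0 < P.ratio ε := div_pos hpos hε
  obtain ⟨xs, hxs⟩ := P.exists_isCompositeMinimizer (smoothingParam_pos hε hY)
    (perturbParam_pos hε hX)
  obtain ⟨T, hT0, hT, hα, hE⟩ := integral_smoothedObjective_gap_le hε hpos hxs
  obtain ⟨K, hK1, hK, hKle, hKle'⟩ :=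
    iteration_count_le (one_le_of_normA_pos hA) hR hl hl1 hT0 hT
  refine ⟨K, hK1, hKle, hKle', fun M hM Ω _ ν _ i hi k hk => ?_⟩
  have hk1 : 1 ≤ k := hK1.trans hk
  have hmem : ∀ a, P.output ε M (fun t => i t a) k ∈ P.X := fun a =>
    ergodicMean_mem P.convex_X hα hM P.x₀_mem P.w₀_subgradient _ hk1
  have hint : ∀ φ : E → ℝ, Integrable (fun a => φ (P.output ε M (fun t => i t a) k)) ν := fun φ =>
    hi.integrable (F := fun i => φ (P.output ε M i k))
      fun _ _ hab => congrArg φ (dependsOn_ergodicMean k hab)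
  refine ⟨hmem, hint fun x => P.Ψ x - P.Ψopt,
    fun a => P.smoothedObjective ε (P.output ε M (fun t => i t a) k) - P.smoothedObjective ε xs,
    hint fun x => P.smoothedObjective ε x - P.smoothedObjective ε xs,
    fun a => sub_nonneg.2 (hxs.isMinOn (hmem a)),
    fun a => gap_le_smoothedObjective_gap hε hX hY hxs.isMinOn (hmem a),
    hE lam hl hl1 M hM Ω ν i hi k hk1 (hK.trans (Nat.cast_le.2 hk))⟩

end StructuredRPDG.Problem

theorem proposition4p3 :
    ∃ C : ℝ, 0 < C ∧
      ∀ (m : ℕ) (E : Type u) [NormedAddCommGroup E] [NormedSpace ℝ E] [FiniteDimensional ℝ E]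
        (F : Fin m → Type v) [∀ i, NormedAddCommGroup (F i)] [∀ i, NormedSpace ℝ (F i)]
        [∀ i, FiniteDimensional ℝ (F i)]
        (P : StructuredRPDG.Problem m E F) (ε : ℝ), 0 < ε → 0 < P.normA * P.ΩX * P.ΩY →
      -- the method is well defined
      (∃ M, P.IsProx ε M) ∧
      -- bound in expectation
      (∃ K : ℕ, 1 ≤ K ∧
        (K : ℝ) ≤ C * ((m + Real.sqrt m * P.ratio ε) * Real.log (m * (2 + P.ratio ε))) ∧
        (2 * Real.sqrt m ≤ P.ratio ε →
          (K : ℝ) ≤ C * (Real.sqrt m * P.ratio ε * Real.log (m * P.ratio ε))) ∧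
        ∀ M, P.IsProx ε M →
        ∀ (Ω : Type w) [MeasurableSpace Ω] (ℙ : MeasureTheory.Measure Ω)
          [MeasureTheory.IsProbabilityMeasure ℙ] (i : ℕ → Ω → Fin m),
          StructuredRPDG.IsSampling ℙ (P.parameters ε).p i →
        ∀ k : ℕ, K ≤ k →
          (∀ a, P.output ε M (fun t => i t a) k ∈ P.X) ∧
          MeasureTheory.Integrable
            (fun a => P.Ψ (P.output ε M (fun t => i t a) k) - P.Ψopt) ℙ ∧
          ∫ a, (P.Ψ (P.output ε M (fun t => i t a) k) - P.Ψopt) ∂ℙ ≤ ε) ∧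
      -- bound with high probability
      (∀ lam : ℝ, 0 < lam → lam < 1 →
        ∃ K : ℕ, 1 ≤ K ∧
          (K : ℝ) ≤
            C * ((m + Real.sqrt m * P.ratio ε) * Real.log (m * (2 + P.ratio ε) / lam)) ∧
          (2 * Real.sqrt m ≤ P.ratio ε →
            (K : ℝ) ≤ C * (Real.sqrt m * P.ratio ε * Real.log (m * P.ratio ε / lam))) ∧
          ∀ M, P.IsProx ε M →
          ∀ (Ω : Type w) [MeasurableSpace Ω] (ℙ : MeasureTheory.Measure Ω)
            [MeasureTheory.IsProbabilityMeasure ℙ] (i : ℕ → Ω → Fin m),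
            StructuredRPDG.IsSampling ℙ (P.parameters ε).p i →
          ∀ k : ℕ, K ≤ k →
            (∀ a, P.output ε M (fun t => i t a) k ∈ P.X) ∧
            ℙ {a | ε < P.Ψ (P.output ε M (fun t => i t a) k) - P.Ψopt} ≤
              ENNReal.ofReal lam) := by
  refine ⟨3000, by norm_num, ?_⟩
  intro m E _ _ _ F _ _ _ P ε hε hpos
  refine ⟨StructuredRPDG.Problem.exists_isProx hε hpos, ?_, fun lam hl hl1 => ?_⟩
  · obtain ⟨K, hK1, hKle, hKle', hK⟩ :=
      StructuredRPDG.Problem.exists_iteration_bound hε hpos one_pos le_rfl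
    rw [div_one] at hKle hKle'
    refine ⟨K, hK1, hKle, hKle', fun M hM Ω _ ℙ _ i hi k hk => ?_⟩
    obtain ⟨hmem, hint, gap, hgap, -, hle, hE⟩ := hK M hM Ω ℙ i hi k hk
    refine ⟨hmem, hint, ?_⟩
    refine (MeasureTheory.integral_mono hint
      (hgap.add (MeasureTheory.integrable_const _)) hle).trans ?_
    rw [MeasureTheory.integral_add' hgap (MeasureTheory.integrable_const _),
      MeasureTheory.integral_const, MeasureTheory.probReal_univ, one_smul]
    linarith
  · obtain ⟨K, hK1, hKle, hKle', hK⟩ :=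
      StructuredRPDG.Problem.exists_iteration_bound hε hpos hl hl1.le
    refine ⟨K, hK1, hKle, hKle', fun M hM Ω _ ℙ _ i hi k hk => ?_⟩
    obtain ⟨hmem, -, gap, hgap, hgap0, hle, hE⟩ := hK M hM Ω ℙ i hi k hk
    refine ⟨hmem, ?_⟩
    -- A failure forces the nonnegative gap above `ε - 3ε/4 = ε/4`, while its mean is at most
    -- `ελ/4`.
    have hmarkov := MeasureTheory.mul_meas_ge_le_integral_of_nonneg
      (MeasureTheory.ae_of_all ℙ hgap0) hgap (ε / 4)
    have hreal : ℙ.real {a | ε / 4 ≤ gap a} ≤ lam := by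
      have h4 : ε / 4 * ℙ.real {a | ε / 4 ≤ gap a} ≤ ε / 4 * lam := by linarith
      exact le_of_mul_le_mul_left h4 (by positivity)
    refine (MeasureTheory.measure_mono fun a ha => ?_).trans
      ((ENNReal.le_ofReal_iff_toReal_le (MeasureTheory.measure_ne_top _ _) hl.le).2 hreal)
    have h1 := hle a
    have h2 : ε < P.Ψ (P.output ε M (fun t => i t a) k) - P.Ψopt := ha
    have h3 : ε / 4 ≤ gap a := by linarith
    exact h3
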